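/- Let $\mathfrak h$ be a finite-dimensional complex vector space with a non-degenerate symmetric bilinear form $(\cdot,\cdot)$ and let $r\in\mathbb C$. Let $\hat{\mathfrak h}=\mathfrak h\otimes\mathbb C[t,t^{-1}]\oplus\mathbb C c$ be the Heisenberg Lie algebra, with $c$ central and $[a(m),b(n)]=m(a,b)\delta_{m+n,0}\,c$ for $a(m)=a\otimes t^m$. Let $\mathfrak L\subset U(\hat{\mathfrak h})$ be the span of $c$ and all products $a(m)b(n)$ ($c$ is redundant if $\mathfrak h\neq 0$), a Lie algebra under $[x,y]_{new}=\frac1c(xy-yx)$. Put $L_{a,b}(m,n)=\frac12 :a(m)b(n):$, where $:a(m)b(n):$ is $b(n)a(m)$ if $m\ge n$ and $a(m)b(n)$ otherwise. Let $\mathfrak B_+=\mathrm{span}\{L_{a,b}(m,n): m\ge 0\text{ or }n\ge 0\}$ and let $M_r=U(\mathfrak L)\otimes_{U(\mathfrak B_+\oplus\mathbb C c)}\mathbb C 1$ be the $\mathfrak L$-module induced from the one-dimensional module on which $\mathfrak B_+$ acts by $0$ and $c$ by $r$. It is graded, the vector $L_{a_1,b_1}(-m_1,-n_1)\cdots L_{a_s,b_s}(-m_s,-n_s)1$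 with all $m_i,n_i\ge1$ having degree $\sum_i(m_i+n_i)$. There is a unique linear functional $1'$ on $M_r$ with $\langle 1',1\rangle=1$ that vanishes on all vectors of positive degree. Put $L_{a,b}(z,w)=\sum_{m,n\in\mathbb Z}L_{a,b}(m,n)z^{-m-1}w^{-n-1}$. For $n\ge 0$ let $D_n$ be the set of diagrams: graphs $D$ on the $2n$ symbols $a_1,b_1,\dots,a_n,b_n$ with exactly $n$ edges, no two of which share a vertex, and with no edge joining $a_i$ to $b_i$ (and no loops). Identifying $a_i$ with $b_i$ for every $i$ turns $D$ into a disjoint union of cycles on $\{1,\dots,n\}$ (two parallel edges count as a cycle of length two), which are, after a choice of orientation, the cycles of a derangement $\sigma_D$ of $\{1,\dots,n\}$; let $c(\sigma_D)$ be their number. Attach the variable $z_i$ to $a_i$ and $w_i$ to $b_i$, write $x_u$ for the variable of the vertex $u$, and put $$R(D;Z,W)=r^{c(\sigma_D)}\prod_{\{u,v\}\in D}\frac{\tfrac12(u,v)}{(x_u-x_v)^2},$$ where $(u,v)$ is the value of the form at the vectors of $\mathfrak h$ that $u$ and $v$ stand for, and $R(\emptyset;Z,W)=1$ if $n=0$.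 Then for all $a_1,b_1,\dots,a_n,b_n\in\mathfrak h$ $$\langle 1',L_{a_1,b_1}(z_1,w_1)\cdots L_{a_n,b_n}(z_n,w_n)1\rangle=\sum_{D\in D_n}R(D;Z,W),$$ both as formal Laurent series, where for an edge $\{u,v\}$ with $u$ in an earlier pair than $v$ the factor $(x_u-x_v)^{-2}$ is expanded in non-negative powers of $x_v$, and analytically: the series on the left, with complex numbers substituted for its variables, converges absolutely to the rational function on the right whenever $|x_u|>|x_v|$ for all $u\in\{a_i,b_i\}$, $v\in\{a_j,b_j\}$ with $i<j$. -/

import Mathlib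

open scoped TensorProduct

namespace JordanVOA
noncomputable section

attribute [local instance 100] LieRing.ofAssociativeRing LieAlgebra.ofAssociativeAlgebra

variable {h : Type*} [AddCommGroup h] [Module ℂ h]

/-- The form `(a t^m, b t^n) ↦ m (a, b) δ_{m+n,0}` on `L(𝔥) = 𝔥 ⊗ ℂ[t, t⁻¹]`, where an element
`∑ aₘ t^m` of `L(𝔥)` is written as the finitely supported function `m ↦ aₘ`. -/
def modeForm (β : LinearMap.BilinForm ℂ h) : LinearMap.BilinForm ℂ (ℤ →₀ h) :=
  Finsupp.lsum ℂ fun m : ℤ => (m : ℂ) • β.compl₂ (Finsupp.lapply (-m))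

theorem modeForm_single (β : LinearMap.BilinForm ℂ h) (m n : ℤ) (a b : h) :
    modeForm β (Finsupp.single m a) (Finsupp.single n b) =
      if m + n = 0 then (m : ℂ) * β a b else 0 := by
  by_cases hmn : m + n = 0
  · have : n = -m := by lia
    simp [modeForm, this]
  · have : n ≠ -m := by lia
    simp [modeForm, hmn, this]

theorem modeForm_skew (β : LinearMap.BilinForm ℂ h) (hβ : β.IsSymm) (x y : ℤ →₀ h) :
    modeForm β x y = -modeForm β y x := by
  induction x using Finsupp.induction_linear with
  | zero => simp
  | add x x' hx hx' => simp only [map_add, LinearMap.add_apply, hx, hx']; ring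
  | single m a =>
    induction y using Finsupp.induction_linear with
    | zero => simp
    | add y y' hy hy' => simp only [map_add, LinearMap.add_apply, hy, hy']; ring
    | single n b =>
      rw [modeForm_single, modeForm_single, add_comm n m]
      by_cases hmn : m + n = 0
      · have : n = -m := by lia
        simp [this, hβ.eq a b]
      · simp [hmn]

/-- The Heisenberg Lie algebra `L(𝔥) ⊕ ℂ c` of a space with a symmetric bilinear form. -/
def Heisenberg (β : LinearMap.BilinForm ℂ h) (_hβ : β.IsSymm) : Type _ := (ℤ →₀ h) × ℂ

variable (β : LinearMap.BilinForm ℂ h) (hβ : β.IsSymm)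

namespace Heisenberg

instance : AddCommGroup (Heisenberg β hβ) := inferInstanceAs (AddCommGroup ((ℤ →₀ h) × ℂ))

instance : Module ℂ (Heisenberg β hβ) := inferInstanceAs (Module ℂ ((ℤ →₀ h) × ℂ))

/-- The projection to `L(𝔥)`. -/
def toLoop : Heisenberg β hβ →ₗ[ℂ] (ℤ →₀ h) := LinearMap.fst ℂ (ℤ →₀ h) ℂ

/-- The coefficient of `c`. -/
def toCentral : Heisenberg β hβ →ₗ[ℂ] ℂ := LinearMap.snd ℂ (ℤ →₀ h) ℂ

/-- The inclusion of `L(𝔥)`. -/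
def ofLoop : (ℤ →₀ h) →ₗ[ℂ] Heisenberg β hβ := LinearMap.inl ℂ (ℤ →₀ h) ℂ

/-- The central element `c`. -/
def c : Heisenberg β hβ := LinearMap.inr ℂ (ℤ →₀ h) ℂ 1

theorem toLoop_ofLoop (x : ℤ →₀ h) : toLoop β hβ (ofLoop β hβ x) = x := rfl

theorem toLoop_c : toLoop β hβ (c β hβ) = 0 := rfl

theorem toCentral_c : toCentral β hβ (c β hβ) = 1 := rfl

theorem toCentral_ofLoop (x : ℤ →₀ h) : toCentral β hβ (ofLoop β hβ x) = 0 := rfl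

variable {β hβ} in
theorem ext {x y : Heisenberg β hβ} (h1 : toLoop β hβ x = toLoop β hβ y)
    (h2 : toCentral β hβ x = toCentral β hβ y) : x = y := Prod.ext h1 h2

/-- The bracket is `[x, y] = (x, y) c` for the form on `L(𝔥)`, so that
`[a t^m, b t^n] = m (a, b) δ_{m+n,0} c`, and `c` is central. -/
instance : LieRing (Heisenberg β hβ) where
  bracket x y := modeForm β (toLoop β hβ x) (toLoop β hβ y) • c β hβ
  add_lie x y z := by simp [add_smul]
  lie_add x y z := by simp [add_smul]
  lie_self x := by
    rw [self_eq_neg.mp (modeForm_skew β hβ (toLoop β hβ x) (toLoop β hβ x)), zero_smul]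
  leibniz_lie x y z := by simp [toLoop_c]

theorem lie_def (x y : Heisenberg β hβ) :
    ⁅x, y⁆ = modeForm β (toLoop β hβ x) (toLoop β hβ y) • c β hβ := rfl

instance : LieAlgebra ℂ (Heisenberg β hβ) where
  lie_smul t x y := by simp [lie_def, mul_smul]

end Heisenberg

/-- The universal enveloping algebra of the Heisenberg Lie algebra. -/
abbrev UHeis : Type _ := UniversalEnvelopingAlgebra ℂ (Heisenberg β hβ)

/-- The element `c` of the enveloping algebra. -/
def central : UHeis β hβ := UniversalEnvelopingAlgebra.ι ℂ (Heisenberg.c β hβ)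

/-- The inclusion of `L(𝔥)` in the enveloping algebra. -/
def loop : (ℤ →₀ h) →ₗ[ℂ] UHeis β hβ :=
  (UniversalEnvelopingAlgebra.ι ℂ : Heisenberg β hβ →ₗ⁅ℂ⁆ UHeis β hβ).toLinearMap ∘ₗ
    Heisenberg.ofLoop β hβ

/-- The element `a(m) = a t^m` of the enveloping algebra. -/
def mode (a : h) (m : ℤ) : UHeis β hβ := loop β hβ (Finsupp.single m a)

theorem iota_comm (x y : Heisenberg β hβ) :
    (UniversalEnvelopingAlgebra.ι ℂ x : UHeis β hβ) * UniversalEnvelopingAlgebra.ι ℂ y -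
      UniversalEnvelopingAlgebra.ι ℂ y * UniversalEnvelopingAlgebra.ι ℂ x =
      modeForm β (Heisenberg.toLoop β hβ x) (Heisenberg.toLoop β hβ y) • central β hβ := by
  rw [← LieRing.of_associative_ring_bracket, ← LieHom.map_lie, central, Heisenberg.lie_def,
    map_smul]

theorem loop_comm (x y : ℤ →₀ h) :
    loop β hβ x * loop β hβ y = loop β hβ y * loop β hβ x + modeForm β x y • central β hβ :=
  sub_eq_iff_eq_add'.mp (iota_comm β hβ (Heisenberg.ofLoop β hβ x) (Heisenberg.ofLoop β hβ y))

theorem mode_comm (a b : h) (m n : ℤ) :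
    mode β hβ a m * mode β hβ b n - mode β hβ b n * mode β hβ a m =
      (if m + n = 0 then (m : ℂ) * β a b else 0) • central β hβ := by
  rw [mode, mode, loop_comm, modeForm_single, add_sub_cancel_left]

theorem central_comm_loop (x : ℤ →₀ h) :
    central β hβ * loop β hβ x = loop β hβ x * central β hβ := by
  have := iota_comm β hβ (Heisenberg.c β hβ) (Heisenberg.ofLoop β hβ x)
  rw [Heisenberg.toLoop_c, map_zero, LinearMap.zero_apply, zero_smul] at this
  exact sub_eq_zero.mp this

/-! ### The space `𝔏` of quadratic elements -/

/-- The space `𝔏` spanned by the products `a(m) b(n)`. The generator `c` is redundant as soon as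
`𝔥 ≠ 0` (see `quadSpan_eq`). -/
def quadSpan : Submodule ℂ (UHeis β hβ) :=
  Submodule.span ℂ ({x | ∃ (a b : h) (m n : ℤ), x = mode β hβ a m * mode β hβ b n} ∪
    {central β hβ})

theorem central_mem : central β hβ ∈ quadSpan β hβ :=
  Submodule.subset_span (Or.inr rfl)

theorem mode_mul_mode_mem (a b : h) (m n : ℤ) :
    mode β hβ a m * mode β hβ b n ∈ quadSpan β hβ :=
  Submodule.subset_span (Or.inl ⟨a, b, m, n, rfl⟩)

/-- For `𝔥 ≠ 0` the space `𝔏` is the span of the products `a(m) b(n)` alone. -/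
theorem quadSpan_eq [Nontrivial h] (hnd : β.Nondegenerate) :
    quadSpan β hβ =
      Submodule.span ℂ {x | ∃ (a b : h) (m n : ℤ), x = mode β hβ a m * mode β hβ b n} := by
  refine le_antisymm (Submodule.span_le.mpr (Set.union_subset Submodule.subset_span ?_))
    (Submodule.span_mono Set.subset_union_left)
  obtain ⟨a, ha⟩ := exists_ne (0 : h)
  obtain ⟨b, hb⟩ : ∃ b, β a b ≠ 0 := by
    by_contra! hall
    exact ha (hnd.1 a hall)
  rintro _ rfl
  have hc : central β hβ = (β a b)⁻¹ • (mode β hβ a 1 * mode β hβ b (-1) -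
      mode β hβ b (-1) * mode β hβ a 1) := by
    rw [mode, mode, loop_comm, modeForm_single, add_sub_cancel_left, smul_smul]
    simp [hb]
  rw [hc]
  exact Submodule.smul_mem _ _ (Submodule.sub_mem _ (Submodule.subset_span ⟨a, b, 1, -1, rfl⟩)
    (Submodule.subset_span ⟨b, a, -1, 1, rfl⟩))

/-- Multiplication `L(𝔥) ⊗ L(𝔥) → U`. -/
def loopMul : (ℤ →₀ h) ⊗[ℂ] (ℤ →₀ h) →ₗ[ℂ] UHeis β hβ :=
  TensorProduct.lift ((LinearMap.mul ℂ (UHeis β hβ)).compl₁₂ (loop β hβ) (loop β hβ))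

theorem loopMul_tmul (x y : ℤ →₀ h) :
    loopMul β hβ (x ⊗ₜ y) = loop β hβ x * loop β hβ y := rfl

theorem loop_mul_loop_mem (x y : ℤ →₀ h) : loop β hβ x * loop β hβ y ∈ quadSpan β hβ := by
  induction x using Finsupp.induction_linear with
  | zero => simp
  | add x x' hx hx' => rw [map_add, add_mul]; exact add_mem hx hx'
  | single m a =>
    induction y using Finsupp.induction_linear with
    | zero => simp
    | add y y' hy hy' => rw [map_add, mul_add]; exact add_mem hy hy'
    | single n b => exact mode_mul_mode_mem β hβ a b m n

theorem exists_of_mem {x : UHeis β hβ} (hx : x ∈ quadSpan β hβ) :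
    ∃ (t : (ℤ →₀ h) ⊗[ℂ] (ℤ →₀ h)) (s : ℂ), x = loopMul β hβ t + s • central β hβ := by
  induction hx using Submodule.span_induction with
  | mem x hx =>
    rcases hx with ⟨a, b, m, n, rfl⟩ | rfl
    · exact ⟨Finsupp.single m a ⊗ₜ Finsupp.single n b, 0, by simp [loopMul_tmul, mode]⟩
    · exact ⟨0, 1, by simp⟩
  | zero => exact ⟨0, 0, by simp⟩
  | add x y _ _ hx hy =>
    obtain ⟨t, s, rfl⟩ := hx
    obtain ⟨t', s', rfl⟩ := hy
    exact ⟨t + t', s + s', by rw [map_add, add_smul]; abel⟩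
  | smul k x _ hx =>
    obtain ⟨t, s, rfl⟩ := hx
    exact ⟨k • t, k * s, by rw [map_smul, smul_add, mul_smul]⟩

theorem quad_identity {R : Type*} [Ring R] [Algebra ℂ R] {A B P Q C : R} {k1 k2 k3 k4 : ℂ}
    (e1 : A * P = P * A + k1 • C) (e2 : B * P = P * B + k2 • C)
    (e3 : A * Q = Q * A + k3 • C) (e4 : B * Q = Q * B + k4 • C)
    (c1 : C * A = A * C) (c3 : C * P = P * C) :
    C * (k2 • (A * Q) + k1 • (B * Q) + k4 • (P * A) + k3 • (P * B)) =
      A * B * (P * Q) - P * Q * (A * B) := by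
  have f1 : A * B * (P * Q) = A * P * B * Q + k2 • (C * A * Q) := by
    rw [show A * B * (P * Q) = A * (B * P) * Q by noncomm_ring, e2, c1]
    simp [mul_add, add_mul, mul_assoc]
  have f2 : A * P * B * Q = P * A * (B * Q) + k1 • (C * B * Q) := by
    rw [e1]
    simp [add_mul, mul_assoc]
  have f3 : P * A * (B * Q) = P * (A * Q) * B + k4 • (C * P * A) := by
    rw [e4, show C * P * A = P * A * C by rw [c3, mul_assoc, c1, mul_assoc]]
    simp [mul_add, mul_assoc]
  have f4 : P * (A * Q) * B = P * Q * (A * B) + k3 • (C * P * B) := by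
    rw [e3, c3]
    simp [mul_add, add_mul, mul_assoc]
  rw [f1, f2, f3, f4]
  simp only [mul_add, mul_smul_comm, mul_assoc]
  abel

/-- For `x, y ∈ 𝔏` the commutator `x y - y x` is `c z` with `z ∈ 𝔏`. -/
theorem exists_bracket {x y : UHeis β hβ} (hx : x ∈ quadSpan β hβ) (hy : y ∈ quadSpan β hβ) :
    ∃ z ∈ quadSpan β hβ, central β hβ * z = x * y - y * x := by
  induction hx using Submodule.span_induction with
  | zero => exact ⟨0, zero_mem _, by simp⟩
  | add x x' _ _ hx hx' =>
    obtain ⟨z, hz, e⟩ := hx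
    obtain ⟨z', hz', e'⟩ := hx'
    exact ⟨z + z', add_mem hz hz', by rw [mul_add, e, e']; noncomm_ring⟩
  | smul k x _ hx =>
    obtain ⟨z, hz, e⟩ := hx
    exact ⟨k • z, Submodule.smul_mem _ _ hz, by
      rw [mul_smul_comm, e, smul_sub, smul_mul_assoc, mul_smul_comm]⟩
  | mem x hx =>
    induction hy using Submodule.span_induction with
    | zero => exact ⟨0, zero_mem _, by simp⟩
    | add y y' _ _ hy hy' =>
      obtain ⟨z, hz, e⟩ := hy
      obtain ⟨z', hz', e'⟩ := hy'
      exact ⟨z + z', add_mem hz hz', by rw [mul_add, e, e']; noncomm_ring⟩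
    | smul k y _ hy =>
      obtain ⟨z, hz, e⟩ := hy
      exact ⟨k • z, Submodule.smul_mem _ _ hz, by
        rw [mul_smul_comm, e, smul_sub, smul_mul_assoc, mul_smul_comm]⟩
    | mem y hy =>
      have hcc : ∀ (a b : h) (m n : ℤ), central β hβ * (mode β hβ a m * mode β hβ b n) =
          mode β hβ a m * mode β hβ b n * central β hβ := by
        intro a b m n
        rw [mode, mode, ← mul_assoc, central_comm_loop, mul_assoc, central_comm_loop, mul_assoc]
      rcases hx with ⟨a, b, m, n, rfl⟩ | rfl
      · rcases hy with ⟨u, v, p, q, rfl⟩ | rfl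
        · refine ⟨modeForm β (.single n b) (.single p u) • (mode β hβ a m * mode β hβ v q) +
            modeForm β (.single m a) (.single p u) • (mode β hβ b n * mode β hβ v q) +
            modeForm β (.single n b) (.single q v) • (mode β hβ u p * mode β hβ a m) +
            modeForm β (.single m a) (.single q v) • (mode β hβ u p * mode β hβ b n), ?_, ?_⟩
          · exact add_mem (add_mem (add_mem (Submodule.smul_mem _ _ (mode_mul_mode_mem β hβ _ _ _ _))
              (Submodule.smul_mem _ _ (mode_mul_mode_mem β hβ _ _ _ _)))
              (Submodule.smul_mem _ _ (mode_mul_mode_mem β hβ _ _ _ _)))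
              (Submodule.smul_mem _ _ (mode_mul_mode_mem β hβ _ _ _ _))
          · have e1 : mode β hβ a m * mode β hβ u p = mode β hβ u p * mode β hβ a m +
              modeForm β (.single m a) (.single p u) • central β hβ := loop_comm ..
            have e2 : mode β hβ b n * mode β hβ u p = mode β hβ u p * mode β hβ b n +
              modeForm β (.single n b) (.single p u) • central β hβ := loop_comm ..
            have e3 : mode β hβ a m * mode β hβ v q = mode β hβ v q * mode β hβ a m +
              modeForm β (.single m a) (.single q v) • central β hβ := loop_comm ..
            have e4 : mode β hβ b n * mode β hβ v q = mode β hβ v q * mode β hβ b n +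
              modeForm β (.single n b) (.single q v) • central β hβ := loop_comm ..
            have c1 : central β hβ * mode β hβ a m = mode β hβ a m * central β hβ :=
              central_comm_loop ..
            have c3 : central β hβ * mode β hβ u p = mode β hβ u p * central β hβ :=
              central_comm_loop ..
            generalize modeForm β (.single m a) (.single p u) = k1 at *
            generalize modeForm β (.single n b) (.single p u) = k2 at *
            generalize modeForm β (.single m a) (.single q v) = k3 at *
            generalize modeForm β (.single n b) (.single q v) = k4 at *
            generalize mode β hβ a m = A at *
            generalize mode β hβ b n = B at *
            generalize mode β hβ u p = P at *
            generalize mode β hβ v q = Q at *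
            generalize central β hβ = C at *
            exact quad_identity e1 e2 e3 e4 c1 c3
        · exact ⟨0, zero_mem _, by rw [mul_zero, hcc, sub_self]⟩
      · rcases hy with ⟨u, v, p, q, rfl⟩ | rfl
        · exact ⟨0, zero_mem _, by rw [mul_zero, hcc, sub_self]⟩
        · exact ⟨0, zero_mem _, by simp⟩


/-!
### Division by `c` is unambiguous on `𝔏`

The enveloping algebra acts on a polynomial ring with `c` acting as `1`, and this action is
faithful on `𝔏`.
-/

/-- A basis of `L(𝔥)`. -/
def loopBasis (h : Type*) [AddCommGroup h] [Module ℂ h] :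
    Module.Basis (Module.Basis.ofVectorSpaceIndex ℂ (ℤ →₀ h)) ℂ (ℤ →₀ h) :=
  Module.Basis.ofVectorSpace ℂ (ℤ →₀ h)

/-- Polynomials in variables indexed by a basis of `L(𝔥)`. -/
abbrev PolyRep (h : Type*) [AddCommGroup h] [Module ℂ h] : Type _ :=
  MvPolynomial (Module.Basis.ofVectorSpaceIndex ℂ (ℤ →₀ h)) ℂ

/-- The linear polynomial of an element of `L(𝔥)`. -/
def polyLin : (ℤ →₀ h) →ₗ[ℂ] PolyRep h :=
  Finsupp.linearCombination ℂ MvPolynomial.X ∘ₗ (loopBasis h).repr.toLinearMap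

theorem polyLin_basis (i : Module.Basis.ofVectorSpaceIndex ℂ (ℤ →₀ h)) :
    polyLin (loopBasis h i) = MvPolynomial.X i := by
  simp [polyLin]

/-- The derivation that sends the linear polynomial of `y` to the constant `(x, y)`. -/
def polyDer : (ℤ →₀ h) →ₗ[ℂ] Module.End ℂ (PolyRep h) where
  toFun x := (MvPolynomial.mkDerivation ℂ fun i =>
    MvPolynomial.C (modeForm β x (loopBasis h i)) : Derivation ℂ (PolyRep h) (PolyRep h))
  map_add' x y := by
    rw [← Derivation.coe_add_linearMap]
    congr 1
    ext i
    simp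
  map_smul' t x := by
    rw [RingHom.id_apply, ← Derivation.coe_smul_linearMap]
    congr 1
    ext i
    simp [MvPolynomial.smul_eq_C_mul]

theorem polyDer_mul (x : ℤ →₀ h) (p q : PolyRep h) :
    polyDer β x (p * q) = p * polyDer β x q + q * polyDer β x p := by
  simp [polyDer]

theorem polyDer_one (x : ℤ →₀ h) : polyDer β x 1 = 0 := by
  simp [polyDer]

theorem polyDer_lin (x y : ℤ →₀ h) :
    polyDer β x (polyLin y) = MvPolynomial.C (modeForm β x y) := by
  have : (polyDer β x ∘ₗ polyLin) =
      (Algebra.linearMap ℂ (PolyRep h)) ∘ₗ (modeForm β x) := by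
    refine (loopBasis h).ext fun i => ?_
    simp [polyDer, polyLin_basis, MvPolynomial.algebraMap_eq]
  exact LinearMap.congr_fun this y

theorem polyDer_comm (x y : ℤ →₀ h) (p : PolyRep h) :
    polyDer β x (polyDer β y p) = polyDer β y (polyDer β x p) := by
  induction p using MvPolynomial.induction_on with
  | C a => simp [polyDer]
  | add p q hp hq => rw [map_add, map_add, map_add, map_add, hp, hq]
  | mul_X p i hp =>
    have hX : ∀ z : ℤ →₀ h, polyDer β z (MvPolynomial.X i : PolyRep h) =
        MvPolynomial.C (modeForm β z (loopBasis h i)) := by simp [polyDer]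
    have hC : ∀ (z : ℤ →₀ h) (t : ℂ), polyDer β z (MvPolynomial.C t : PolyRep h) = 0 := by
      simp [polyDer]
    simp only [polyDer_mul, map_add, hX, hC, hp]
    ring

/-- The action of `x ∈ L(𝔥)`: multiplication by `x` plus half the derivation of `x`. -/
def polyOp : (ℤ →₀ h) →ₗ[ℂ] Module.End ℂ (PolyRep h) :=
  LinearMap.mul ℂ (PolyRep h) ∘ₗ polyLin + (1 / 2 : ℂ) • polyDer β

theorem polyOp_apply (x : ℤ →₀ h) (p : PolyRep h) :
    polyOp β x p = polyLin x * p + (1 / 2 : ℂ) • polyDer β x p := rfl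

theorem polyOp_comm (hβ : β.IsSymm) (x y : ℤ →₀ h) :
    polyOp β x * polyOp β y - polyOp β y * polyOp β x = modeForm β x y • 1 := by
  refine LinearMap.ext fun p => ?_
  have hC : ∀ (z : ℤ →₀ h) (t : ℂ), polyDer β z (MvPolynomial.C t : PolyRep h) = 0 := by
    simp [polyDer]
  simp only [LinearMap.sub_apply, Module.End.mul_apply, polyOp_apply, map_add, hC,
    polyDer_mul, polyDer_lin, LinearMap.smul_apply, Module.End.one_apply, polyDer_comm β x y,
    modeForm_skew β hβ y x, MvPolynomial.smul_eq_C_mul, map_neg]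
  have : (MvPolynomial.C (1 / 2 : ℂ) : PolyRep h) + MvPolynomial.C (1 / 2 : ℂ) = 1 := by
    rw [← map_add]; norm_num
  linear_combination (MvPolynomial.C (modeForm β x y) * p) * this

/-- The representation of the enveloping algebra in which `c` acts as `1`. -/
def polyHom : UHeis β hβ →ₐ[ℂ] Module.End ℂ (PolyRep h) :=
  UniversalEnvelopingAlgebra.lift ℂ
    { toLinearMap := polyOp β ∘ₗ Heisenberg.toLoop β hβ +
        (LinearMap.toSpanSingleton ℂ (Module.End ℂ (PolyRep h)) 1) ∘ₗ Heisenberg.toCentral β hβ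
      map_lie' := by
        intro x y
        have := polyOp_comm β hβ (Heisenberg.toLoop β hβ x) (Heisenberg.toLoop β hβ y)
        simp only [Heisenberg.lie_def, LieRing.of_associative_ring_bracket]
        simp [Heisenberg.toLoop_c, Heisenberg.toCentral_c, mul_add, add_mul, ← this]
        rw [smul_comm (Heisenberg.toCentral β hβ y)]
        abel }

theorem polyHom_loop (x : ℤ →₀ h) : polyHom β hβ (loop β hβ x) = polyOp β x := by
  rw [polyHom, loop, LinearMap.comp_apply, LieHom.coe_toLinearMap,
    UniversalEnvelopingAlgebra.lift_ι_apply]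
  change polyOp β (Heisenberg.toLoop β hβ (Heisenberg.ofLoop β hβ x)) +
    Heisenberg.toCentral β hβ (Heisenberg.ofLoop β hβ x) • (1 : Module.End ℂ (PolyRep h)) = _
  rw [Heisenberg.toLoop_ofLoop, Heisenberg.toCentral_ofLoop, zero_smul, add_zero]

theorem polyHom_central : polyHom β hβ (central β hβ) = 1 := by
  rw [polyHom, central, UniversalEnvelopingAlgebra.lift_ι_apply]
  change polyOp β (Heisenberg.toLoop β hβ (Heisenberg.c β hβ)) +
    Heisenberg.toCentral β hβ (Heisenberg.c β hβ) • (1 : Module.End ℂ (PolyRep h)) = _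
  rw [Heisenberg.toLoop_c, Heisenberg.toCentral_c, map_zero, one_smul, zero_add]

theorem eq_zero_of_polyHom {z : UHeis β hβ} (hz : z ∈ quadSpan β hβ) (h0 : polyHom β hβ z = 0) :
    z = 0 := by
  obtain ⟨t, s, rfl⟩ := exists_of_mem β hβ hz
  let V := ℤ →₀ h
  let ω : V ⊗[ℂ] V →ₗ[ℂ] ℂ := TensorProduct.lift (modeForm β)
  let prodP : V ⊗[ℂ] V →ₗ[ℂ] PolyRep h :=
    TensorProduct.lift ((LinearMap.mul ℂ (PolyRep h)).compl₁₂ polyLin polyLin)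
  let swap : V ⊗[ℂ] V →ₗ[ℂ] V ⊗[ℂ] V := (TensorProduct.comm ℂ V V).toLinearMap
  -- the value at the constant polynomial `1`
  have h1 : ∀ t : V ⊗[ℂ] V, polyHom β hβ (loopMul β hβ t) 1 =
      prodP t + MvPolynomial.C ((1 / 2 : ℂ) * ω t) := by
    intro t
    induction t with
    | zero => simp
    | add t t' ht ht' => simp only [map_add, LinearMap.add_apply, ht, ht', mul_add]; abel
    | tmul x y =>
      rw [loopMul_tmul, map_mul, Module.End.mul_apply, polyHom_loop, polyHom_loop, polyOp_apply,
        polyOp_apply, polyDer_one, smul_zero, add_zero, mul_one, polyDer_lin, map_mul,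
        MvPolynomial.smul_eq_C_mul]
      rfl
  -- symmetrization
  have h2 : ∀ t : V ⊗[ℂ] V, loopMul β hβ t = (1 / 2 : ℂ) • loopMul β hβ (t + swap t) +
      ((1 / 2 : ℂ) * ω t) • central β hβ := by
    intro t
    induction t with
    | zero => simp
    | add t t' ht ht' =>
      simp only [map_add] at ht ht' ⊢
      refine (congrArg₂ (· + ·) ht ht').trans ?_
      module
    | tmul x y =>
      have : swap (x ⊗ₜ y) = y ⊗ₜ x := rfl
      rw [this, map_add, loopMul_tmul, loopMul_tmul, loop_comm β hβ x y]
      simp only [ω, TensorProduct.lift.tmul]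
      module
  have h3 : ∀ i j, ∀ t : V ⊗[ℂ] V,
      ((loopBasis h).tensorProduct (loopBasis h)).repr (t + swap t) (i, j) =
        MvPolynomial.constantCoeff (MvPolynomial.pderiv i (MvPolynomial.pderiv j (prodP t))) := by
    classical
    intro i j t
    have hlin : ∀ (k) (x : V), MvPolynomial.pderiv k (polyLin x : PolyRep h) =
        MvPolynomial.C ((loopBasis h).repr x k) := by
      intro k x
      have : ((MvPolynomial.pderiv k : Derivation ℂ (PolyRep h) (PolyRep h)).toLinearMap ∘ₗ
          polyLin) = (Algebra.linearMap ℂ (PolyRep h)) ∘ₗ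
            (Finsupp.lapply k ∘ₗ (loopBasis h).repr.toLinearMap) := by
        refine (loopBasis h).ext fun l => ?_
        by_cases hl : l = k <;>
          simp [polyLin_basis, MvPolynomial.pderiv_X, MvPolynomial.algebraMap_eq, hl]
      exact LinearMap.congr_fun this x
    induction t with
    | zero => simp
    | add t t' ht ht' =>
      simp only [map_add, Finsupp.add_apply] at ht ht' ⊢
      rw [← ht, ← ht']
      ring
    | tmul x y =>
      have : swap (x ⊗ₜ y) = y ⊗ₜ x := rfl
      rw [this]
      simp [prodP, hlin, mul_comm]
  have hP := congrArg (fun f : Module.End ℂ (PolyRep h) => f 1) h0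
  simp only [map_add, map_smul, polyHom_central, LinearMap.add_apply, LinearMap.smul_apply,
    Module.End.one_apply, h1, LinearMap.zero_apply] at hP
  have hlin0 : ∀ x : V, MvPolynomial.constantCoeff (polyLin x : PolyRep h) = 0 := by
    intro x
    have : ((MvPolynomial.aeval (R := ℂ) (fun _ => (0 : ℂ))).toLinearMap ∘ₗ
        (polyLin : V →ₗ[ℂ] PolyRep h)) = 0 := by
      refine (loopBasis h).ext fun l => ?_
      simp [polyLin_basis]
    have h' := LinearMap.congr_fun this x
    simpa [MvPolynomial.aeval_eq_eval, MvPolynomial.eval_zero'] using h'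
  have hprod0 : ∀ t, MvPolynomial.constantCoeff (prodP t) = 0 := by
    intro t
    induction t with
    | zero => simp
    | add t t' ht ht' => rw [map_add, map_add, ht, ht', add_zero]
    | tmul x y => simp [prodP, hlin0]
  have hs : (1 / 2 : ℂ) * ω t + s = 0 := by
    have := congrArg MvPolynomial.constantCoeff hP
    simpa [hprod0, MvPolynomial.smul_eq_C_mul] using this
  have hp : prodP t = 0 := by
    have : prodP t + MvPolynomial.C ((1 / 2 : ℂ) * ω t + s) = 0 := by
      rw [← hP, MvPolynomial.smul_eq_C_mul, map_add]
      ring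
    rwa [hs, map_zero, add_zero] at this
  have hsym : t + swap t = 0 := by
    apply ((loopBasis h).tensorProduct (loopBasis h)).repr.injective
    ext ⟨i, j⟩
    rw [h3, hp]
    simp
  rw [h2 t, hsym, map_zero, smul_zero, zero_add, ← add_smul, hs, zero_smul]

/-- An element `z` of `𝔏` is determined by `c z`. -/
theorem eq_of_central_mul_eq {z z' : UHeis β hβ} (hz : z ∈ quadSpan β hβ)
    (hz' : z' ∈ quadSpan β hβ) (e : central β hβ * z = central β hβ * z') : z = z' := by
  refine sub_eq_zero.mp (eq_zero_of_polyHom β hβ (sub_mem hz hz') ?_)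
  have := congrArg (polyHom β hβ) e
  rw [map_mul, map_mul, polyHom_central, one_mul, one_mul] at this
  rw [map_sub, this, sub_self]

/-! ### The Lie algebra `𝔏` -/

/-- The space `𝔏`, to be equipped with the Lie bracket `[x, y]_new = (1 / c) (x y - y x)`. -/
def quadLie : Type _ := quadSpan β hβ

namespace quadLie

instance : AddCommGroup (quadLie β hβ) := inferInstanceAs (AddCommGroup (quadSpan β hβ))

instance : Module ℂ (quadLie β hβ) := inferInstanceAs (Module ℂ (quadSpan β hβ))

/-- The inclusion of `𝔏` in the enveloping algebra of the Heisenberg Lie algebra. -/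
def toU : quadLie β hβ →ₗ[ℂ] UHeis β hβ := (quadSpan β hβ).subtype

theorem toU_mem (x : quadLie β hβ) : toU β hβ x ∈ quadSpan β hβ := x.2

/-- An element of `𝔏` from an element of the enveloping algebra. -/
def mk (x : UHeis β hβ) (hx : x ∈ quadSpan β hβ) : quadLie β hβ := ⟨x, hx⟩

theorem toU_mk (x : UHeis β hβ) (hx : x ∈ quadSpan β hβ) : toU β hβ (mk β hβ x hx) = x := rfl

/-- The bracket `[x, y]_new` is the element `z` of `𝔏` with `c z = x y - y x`; see
`central_mul_lie` for this property and `ext_central` for its uniqueness. -/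
instance : Bracket (quadLie β hβ) (quadLie β hβ) where
  bracket x y := mk β hβ (exists_bracket β hβ (toU_mem β hβ x) (toU_mem β hβ y)).choose
    (exists_bracket β hβ (toU_mem β hβ x) (toU_mem β hβ y)).choose_spec.1

theorem central_mul_lie (x y : quadLie β hβ) :
    central β hβ * toU β hβ ⁅x, y⁆ = toU β hβ x * toU β hβ y - toU β hβ y * toU β hβ x :=
  (exists_bracket β hβ (toU_mem β hβ x) (toU_mem β hβ y)).choose_spec.2

variable {β hβ} in
theorem ext_central {x y : quadLie β hβ}
    (e : central β hβ * toU β hβ x = central β hβ * toU β hβ y) : x = y :=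
  Subtype.ext (eq_of_central_mul_eq β hβ (toU_mem β hβ x) (toU_mem β hβ y) e)

theorem polyHom_lie (x y : quadLie β hβ) :
    polyHom β hβ (toU β hβ ⁅x, y⁆) = polyHom β hβ (toU β hβ x) * polyHom β hβ (toU β hβ y) -
      polyHom β hβ (toU β hβ y) * polyHom β hβ (toU β hβ x) := by
  have := congrArg (polyHom β hβ) (central_mul_lie β hβ x y)
  simpa [polyHom_central] using this

variable {β hβ} in
theorem ext_polyHom {x y : quadLie β hβ}
    (e : polyHom β hβ (toU β hβ x) = polyHom β hβ (toU β hβ y)) : x = y :=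
  ext_central (congrArg _ (sub_eq_zero.mp (eq_zero_of_polyHom β hβ
    (sub_mem (toU_mem β hβ x) (toU_mem β hβ y)) (by rw [map_sub, e, sub_self]))))

instance : LieRing (quadLie β hβ) where
  add_lie x y z := ext_polyHom (by simp only [map_add, polyHom_lie]; noncomm_ring)
  lie_add x y z := ext_polyHom (by simp only [map_add, polyHom_lie]; noncomm_ring)
  lie_self x := ext_polyHom (by simp only [map_zero, polyHom_lie, sub_self])
  leibniz_lie x y z := ext_polyHom (by
    simp only [map_add, polyHom_lie, mul_sub, sub_mul, mul_assoc]
    abel)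

instance : LieAlgebra ℂ (quadLie β hβ) where
  lie_smul t x y := ext_polyHom (by
    simp only [map_smul, polyHom_lie, mul_smul_comm, smul_mul_assoc, smul_sub])

/-- The element `c` of `𝔏`. -/
def c : quadLie β hβ := mk β hβ (central β hβ) (central_mem β hβ)

end quadLie

/-- The normal ordered product `:a(m) b(n):`. -/
def normalOrder (a b : h) (m n : ℤ) : UHeis β hβ :=
  if n ≤ m then mode β hβ b n * mode β hβ a m else mode β hβ a m * mode β hβ b n

theorem normalOrder_mem (a b : h) (m n : ℤ) : normalOrder β hβ a b m n ∈ quadSpan β hβ := by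
  unfold normalOrder
  split_ifs
  · exact mode_mul_mode_mem β hβ b a n m
  · exact mode_mul_mode_mem β hβ a b m n

/-- `L_{a,b}(m, n) = (1 / 2) :a(m) b(n):`. -/
def quadL (a b : h) (m n : ℤ) : quadLie β hβ :=
  (1 / 2 : ℂ) • quadLie.mk β hβ (normalOrder β hβ a b m n) (normalOrder_mem β hβ a b m n)

/-- `𝔅₊`, the span of the `L_{a,b}(m, n)` with `m ≥ 0` or `n ≥ 0`. -/
def quadBPlus : Submodule ℂ (quadLie β hβ) :=
  Submodule.span ℂ {x | ∃ (a b : h) (m n : ℤ), (0 ≤ m ∨ 0 ≤ n) ∧ x = quadL β hβ a b m n}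

/-- The universal enveloping algebra `U(𝔏)` of `𝔏` with the bracket `[x, y]_new`. -/
abbrev UQuad : Type _ := UniversalEnvelopingAlgebra ℂ (quadLie β hβ)

/-- The left ideal of `U(𝔏)` generated by `𝔅₊` and `c - r`. -/
def vacuumIdeal (r : ℂ) : Submodule (UQuad β hβ) (UQuad β hβ) :=
  Submodule.span (UQuad β hβ)
    ({u | ∃ x ∈ quadBPlus β hβ, u = UniversalEnvelopingAlgebra.ι ℂ x} ∪
      {UniversalEnvelopingAlgebra.ι ℂ (quadLie.c β hβ) - algebraMap ℂ (UQuad β hβ) r})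

/-- The module `M_r` induced from the one-dimensional module `ℂ 1` of `𝔏₊ = 𝔅₊ ⊕ ℂ c` on which
`𝔅₊` acts by zero and `c` by `r`, as the quotient of `U(𝔏)` by the left ideal that annihilates the
generator. -/
abbrev VacModule (r : ℂ) : Type _ := UQuad β hβ ⧸ vacuumIdeal β hβ r

/-- The generator `1` of `M_r`. -/
def vacuum (r : ℂ) : VacModule β hβ r := (vacuumIdeal β hβ r).mkQ 1

/-- `L_{a,b}(m, n)` as an element of `U(𝔏)`; it acts on `M_r` by `•`. -/
def opL (a b : h) (m n : ℤ) : UQuad β hβ := UniversalEnvelopingAlgebra.ι ℂ (quadL β hβ a b m n)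

/-- The homogeneous subspace of degree `k` of `M_r`, spanned by the vectors
`L_{a₁,b₁}(-m₁,-n₁) ⋯ L_{aₛ,bₛ}(-mₛ,-nₛ) 1` with `mᵢ, nᵢ ≥ 1` and `∑ (mᵢ + nᵢ) = k`. -/
def degreeSpace (r : ℂ) (k : ℕ) : Submodule ℂ (VacModule β hβ r) :=
  Submodule.span ℂ {v | ∃ (s : ℕ) (a b : Fin s → h) (m n : Fin s → ℕ),
    (∀ i, 1 ≤ m i ∧ 1 ≤ n i) ∧ ∑ i, (m i + n i) = k ∧
    v = (List.ofFn fun i => opL β hβ (a i) (b i) (-(m i : ℤ)) (-(n i : ℤ))).prod • vacuum β hβ r}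

/-- The functional `1'`: it is `1` on the vacuum and `0` on each positive degree. -/
structure IsVacuumDual (r : ℂ) (φ : Module.Dual ℂ (VacModule β hβ r)) : Prop where
  map_vacuum : φ (vacuum β hβ r) = 1
  map_positive : ∀ k : ℕ, 1 ≤ k → ∀ v ∈ degreeSpace β hβ r k, φ v = 0

/-- The vertices of diagrams over `(a₁, b₁) ⋯ (aₙ, bₙ)`: `.inl i` is the symbol `aᵢ` and `.inr i` is
the symbol `bᵢ`. -/
abbrev Vertex (n : ℕ) : Type := Fin n ⊕ Fin n

/-- The index of the pair that contains a vertex. -/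
def pairIndex {n : ℕ} : Vertex n → Fin n := Sum.elim id id

/-- The formal series `⟨1', L_{a₁,b₁}(z₁, w₁) ⋯ L_{aₙ,bₙ}(zₙ, wₙ) 1⟩` for `φ = 1'`, where
`L_{a,b}(z, w) = ∑ L_{a,b}(m, n) z^{-m-1} w^{-n-1}`, as the family of its coefficients:
`correlation β hβ φ a b k` is the coefficient of `∏ zᵢ ^ k (.inl i) * wᵢ ^ k (.inr i)`. -/
def correlation {r : ℂ} (φ : Module.Dual ℂ (VacModule β hβ r)) {n : ℕ} (a b : Fin n → h)
    (k : Vertex n → ℤ) : ℂ :=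
  φ ((List.ofFn fun i => opL β hβ (a i) (b i) (-k (.inl i) - 1) (-k (.inr i) - 1)).prod •
    vacuum β hβ r)

/-- A diagram, given by its set of edges: `n` pairwise disjoint edges, none inside a pair. -/
structure IsDiagram {n : ℕ} (E : Finset (Sym2 (Vertex n))) : Prop where
  card_eq : E.card = n
  not_within_pair : ∀ i : Fin n, s(.inl i, .inr i) ∉ E ∧ s(.inl i, .inl i) ∉ E ∧
    s(.inr i, .inr i) ∉ E
  disjoint : ∀ e ∈ E, ∀ f ∈ E, e ≠ f → ∀ v : Vertex n, v ∈ e → v ∉ f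

open scoped Classical in
/-- The finite set of all diagrams. -/
def diagrams (n : ℕ) : Finset (Finset (Sym2 (Vertex n))) :=
  Finset.univ.filter IsDiagram

/-- The graph on `1, …, n` that a diagram becomes when `aᵢ` and `bᵢ` are identified for every `i`.
It is a disjoint union of cycles (two parallel edges form a cycle of length two). -/
def pairGraph {n : ℕ} (E : Finset (Sym2 (Vertex n))) : SimpleGraph (Fin n) :=
  SimpleGraph.fromRel fun i j => ∃ u v : Vertex n, pairIndex u = i ∧ pairIndex v = j ∧ s(u, v) ∈ E

/-- The number `c(σ_D)` of these cycles, which are the cycles of the derangement of the diagram. -/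
def cycleCount {n : ℕ} (E : Finset (Sym2 (Vertex n))) : ℕ :=
  Nat.card (pairGraph E).ConnectedComponent

/-- The label of a vertex in `𝔥`. -/
def label {n : ℕ} (a b : Fin n → h) : Vertex n → h := Sum.elim a b

/-- The rational function `Q(e) = (1 / 2) (u, v) / (x_u - x_v) ^ 2` of an edge `e = {u, v}`. -/
def edgeWeight {n : ℕ} (a b : Fin n → h) (x : Vertex n → ℂ) : Sym2 (Vertex n) → ℂ :=
  Sym2.lift ⟨fun u v => 1 / 2 * β (label a b u) (label a b v) / (x u - x v) ^ 2, fun u v => by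
    beta_reduce
    rw [show β (label a b u) (label a b v) = β (label a b v) (label a b u) from hβ.eq _ _,
      show (x u - x v) ^ 2 = (x v - x u) ^ 2 by ring]⟩

/-- `R(D) = r ^ c(σ_D) * ∏ Q(e)`, the product over the edges `e` of the diagram. -/
def diagramWeight (r : ℂ) {n : ℕ} (a b : Fin n → h) (x : Vertex n → ℂ)
    (E : Finset (Sym2 (Vertex n))) : ℂ :=
  r ^ cycleCount E * ∏ e ∈ E, edgeWeight β hβ a b x e

/-- The coefficient of `x ^ k * y ^ l` in the expansion
`(x - y)⁻² = ∑_{l ≥ 0} (l + 1) x ^ (-l-2) y ^ l` in the domain `|x| > |y|`. -/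
def iotaCoeff (k l : ℤ) : ℂ := if 0 ≤ l ∧ k + l = -2 then (l : ℂ) + 1 else 0

/-- The coefficient of `x_u ^ k u * x_v ^ k v` in the expansion of `Q(e)`, `e = {u, v}`, in the
domain in which the variable of the pair with the smaller index is the larger one (the last
branch, for two vertices of one pair, is irrelevant for diagrams). -/
def edgeCoeff {n : ℕ} (a b : Fin n → h) (k : Vertex n → ℤ) : Sym2 (Vertex n) → ℂ :=
  Sym2.lift ⟨fun u v => 1 / 2 * β (label a b u) (label a b v) *
    (if pairIndex u < pairIndex v then iotaCoeff (k u) (k v)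
      else if pairIndex v < pairIndex u then iotaCoeff (k v) (k u) else 0), fun u v => by
    beta_reduce
    rw [show β (label a b u) (label a b v) = β (label a b v) (label a b u) from hβ.eq _ _]
    split_ifs with h1 h2 h2
    · exact absurd h1 h2.asymm
    all_goals rfl⟩

/-- The coefficient of `∏ x_v ^ k v` in the expansion of `R(D)` in the domain in which the variables
of each pair are larger than those of all later pairs. Every vertex lies on exactly one edge of the
diagram, so it is the product of the coefficients of the edges. -/
def diagramCoeff (r : ℂ) {n : ℕ} (a b : Fin n → h) (E : Finset (Sym2 (Vertex n)))
    (k : Vertex n → ℤ) : ℂ :=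
  r ^ cycleCount E * ∏ e ∈ E, edgeCoeff β hβ a b k e

end
end JordanVOA

/-! When `r = N` is a natural number, the module can be modelled on a Fock space with `N` colours,
that is, `N` commuting copies of the Heisenberg algebra, each with `c` acting as `1`. In a single
colour the new bracket becomes the ordinary commutator, and different colours commute. So the sum
over the colours of the actions on quadratic elements represents `𝔏`, and it sends `c` to `N`
(`fockLie`, `fockLie_c`). Each `L_{a,b}(m, n)` becomes half a sum over colours of normal ordered
products. Wick's theorem (`vacuum_expectation_eq_hafnian`) turns the vacuum expectation of a
product, for a fixed colouring of the pairs, into a sum over perfect matchings. Only matchings with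
no edge inside a pair and all edges joining equal colours contribute. Summing over colourings counts
those constant on each cycle, and there are `N ^ c(σ_D)` of them (`sum_prod_sameColor`).

An arbitrary complex `r` is reached by interpolation. On words in the `L_{a,b}(m, n)` times powers
of `c`, which span `U(𝔏)`, the level `N` expectation is the value at `N` of a polynomial. Linearity
extends this to all of `U(𝔏)` (`fockFunctional_mem_range`). A complex polynomial is determined by
its values on `ℕ`, so there is one linear functional `U(𝔏) → ℂ[X]` specializing to every level.
Right multiplication by `c` becomes multiplication by `X`, and right multiplication by `𝔅₊` gives
zero. Evaluation at `r` therefore kills the left ideal defining `M_r` and descends to a functional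
on `M_r` that has the properties of `1'`. Well-definedness comes from the Fock spaces, so no basis
of `U(𝔏)` or of `M_r` is needed.

Uniqueness holds because words with only negative modes span `M_r` (`creationSpan_eq_top`). For
convergence, each diagram coefficient is a product over disjoint edges, so its series is a finite
product of absolutely convergent expansions of `(x - y)⁻²` (`hasSum_prod_edgeCoeff`). -/

namespace JordanVOA
noncomputable section

attribute [local instance 100] LieRing.ofAssociativeRing LieAlgebra.ofAssociativeAlgebra

/-! ### Perfect matchings and hafnians -/

section Hafnian

variable {V : Type*}

/-- `E` is the edge set of a perfect matching of the vertices in `S`. -/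
structure IsPerfectMatching (S : Finset V) (E : Finset (Sym2 V)) : Prop where
  not_isDiag : ∀ e ∈ E, ¬e.IsDiag
  eq_of_mem : ∀ e ∈ E, ∀ f ∈ E, ∀ v : V, v ∈ e → v ∈ f → e = f
  mem_iff : ∀ v, v ∈ S ↔ ∃ e ∈ E, v ∈ e

open scoped Classical in
/-- The perfect matchings of `S`. -/
def perfectMatchings [Fintype V] (S : Finset V) : Finset (Finset (Sym2 V)) :=
  Finset.univ.filter (IsPerfectMatching S)

theorem mem_perfectMatchings [Fintype V] {S : Finset V} {E : Finset (Sym2 V)} :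
    E ∈ perfectMatchings S ↔ IsPerfectMatching S E := by
  simp [perfectMatchings]

/-- The hafnian: the sum over the perfect matchings of `S` of the products of the edge weights. -/
def hafnian [Fintype V] (W : Sym2 V → ℂ) (S : Finset V) : ℂ :=
  ∑ E ∈ perfectMatchings S, ∏ e ∈ E, W e

theorem card_eq_two_mul_card [DecidableEq V] {S : Finset V} {E : Finset (Sym2 V)}
    (hE : IsPerfectMatching S E) : S.card = 2 * E.card := by
  have hS : S = E.biUnion Sym2.toFinset := by
    ext v
    simp [hE.mem_iff]
  rw [hS, Finset.card_biUnion, Finset.sum_congr rfl fun e he =>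
    Sym2.card_toFinset_of_not_isDiag e (hE.not_isDiag e he)]
  · simp [mul_comm]
  · intro e he f hf hef
    refine Finset.disjoint_left.mpr fun v hv hv' => hef ?_
    exact hE.eq_of_mem e he f hf v (Sym2.mem_toFinset.mp hv) (Sym2.mem_toFinset.mp hv')

theorem hafnian_empty [Fintype V] (W : Sym2 V → ℂ) : hafnian W ∅ = 1 := by
  have : perfectMatchings (∅ : Finset V) = {∅} := by
    ext E
    rw [mem_perfectMatchings, Finset.mem_singleton]
    constructor
    · intro hE
      refine Finset.eq_empty_of_forall_notMem fun e he => ?_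
      induction e with
      | h u v => exact Finset.notMem_empty u ((hE.mem_iff u).mpr ⟨_, he, Sym2.mem_mk_left u v⟩)
    · rintro rfl
      constructor <;> simp
  simp [hafnian, this]

theorem IsPerfectMatching.exists_unique_partner [DecidableEq V] {S : Finset V}
    {E : Finset (Sym2 V)} (hE : IsPerfectMatching S E) {u : V} (hu : u ∈ S) :
    ∃! w, w ∈ S.erase u ∧ s(u, w) ∈ E := by
  obtain ⟨e, he, hue⟩ := (hE.mem_iff u).mp hu
  obtain ⟨w, rfl⟩ := hue
  have hne : w ≠ u := fun h => hE.not_isDiag _ he (by simp [h])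
  refine ⟨w, ⟨Finset.mem_erase.mpr ⟨hne, (hE.mem_iff w).mpr ⟨_, he, Sym2.mem_mk_right u w⟩⟩, he⟩,
    fun w' hw' => ?_⟩
  have := hE.eq_of_mem _ he _ hw'.2 u (Sym2.mem_mk_left u w) (Sym2.mem_mk_left u w')
  exact (Sym2.congr_right.mp this).symm

theorem IsPerfectMatching.erase_edge [DecidableEq V] {S : Finset V} {E : Finset (Sym2 V)}
    (hE : IsPerfectMatching S E) {u w : V} (hw : s(u, w) ∈ E) :
    IsPerfectMatching ((S.erase u).erase w) (E.erase s(u, w)) where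
  not_isDiag e he := hE.not_isDiag e (Finset.mem_of_mem_erase he)
  eq_of_mem e he f hf :=
    hE.eq_of_mem e (Finset.mem_of_mem_erase he) f (Finset.mem_of_mem_erase hf)
  mem_iff v := by
    simp only [Finset.mem_erase, hE.mem_iff v]
    constructor
    · rintro ⟨hvw, hvu, e, he, hve⟩
      refine ⟨e, ⟨?_, he⟩, hve⟩
      rintro rfl
      rcases Sym2.mem_iff.mp hve with h | h <;> contradiction
    · rintro ⟨e, ⟨hne, he⟩, hve⟩
      refine ⟨?_, ?_, e, he, hve⟩
      · rintro rfl
        exact hne (hE.eq_of_mem _ he _ hw v hve (Sym2.mem_mk_right u v))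
      · rintro rfl
        exact hne (hE.eq_of_mem _ he _ hw v hve (Sym2.mem_mk_left v w))

theorem IsPerfectMatching.notMem_of_erase [DecidableEq V] {S : Finset V} {E : Finset (Sym2 V)}
    {u w : V} (hE : IsPerfectMatching ((S.erase u).erase w) E) : s(u, w) ∉ E := fun h =>
  Finset.notMem_erase w _ ((hE.mem_iff w).mpr ⟨_, h, Sym2.mem_mk_right u w⟩)

theorem IsPerfectMatching.insert_edge [DecidableEq V] {S : Finset V} {E : Finset (Sym2 V)}
    {u w : V} (hu : u ∈ S) (hw : w ∈ S.erase u)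
    (hE : IsPerfectMatching ((S.erase u).erase w) E) :
    IsPerfectMatching S (insert s(u, w) E) := by
  have hfree : ∀ e ∈ E, ∀ v, v ∈ e → v ≠ u ∧ v ≠ w ∧ v ∈ S := fun e he v hv => by
    have := (hE.mem_iff v).mpr ⟨e, he, hv⟩
    simp only [Finset.mem_erase] at this
    exact ⟨this.2.1, this.1, this.2.2⟩
  have hne := (Finset.mem_erase.mp hw).1
  have hwS := (Finset.mem_erase.mp hw).2
  refine ⟨fun e he => ?_, fun e he f hf v hve hvf => ?_, fun v => ⟨fun hv => ?_, ?_⟩⟩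
  · rcases Finset.mem_insert.mp he with rfl | he
    · simpa using hne.symm
    · exact hE.not_isDiag e he
  · rcases Finset.mem_insert.mp he with rfl | he <;> rcases Finset.mem_insert.mp hf with rfl | hf
    · rfl
    · have := hfree f hf v hvf
      rcases Sym2.mem_iff.mp hve with h | h <;> simp [h] at this
    · have := hfree e he v hve
      rcases Sym2.mem_iff.mp hvf with h | h <;> simp [h] at this
    · exact hE.eq_of_mem e he f hf v hve hvf
  · by_cases hvu : v = u
    · exact ⟨_, Finset.mem_insert_self _ _, by simp [hvu]⟩
    by_cases hvw : v = w
    · exact ⟨_, Finset.mem_insert_self _ _, by simp [hvw]⟩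
    obtain ⟨e, he, hve⟩ := (hE.mem_iff v).mp (by simp [hvu, hvw, hv])
    exact ⟨e, Finset.mem_insert_of_mem he, hve⟩
  · rintro ⟨e, he, hve⟩
    rcases Finset.mem_insert.mp he with rfl | he
    · rcases Sym2.mem_iff.mp hve with rfl | rfl <;> assumption
    · exact (hfree e he v hve).2.2

/-- Expansion of the hafnian with respect to a vertex. -/
theorem hafnian_eq_sum_erase [Fintype V] [DecidableEq V] (W : Sym2 V → ℂ) {S : Finset V} {u : V}
    (hu : u ∈ S) :
    hafnian W S = ∑ w ∈ S.erase u, W s(u, w) * hafnian W ((S.erase u).erase w) := by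
  have h1 : hafnian W S = ∑ E ∈ perfectMatchings S, ∑ w ∈ S.erase u,
      if s(u, w) ∈ E then ∏ e ∈ E, W e else 0 := by
    refine Finset.sum_congr rfl fun E hE => ?_
    obtain ⟨w, hw, huniq⟩ := (mem_perfectMatchings.mp hE).exists_unique_partner hu
    rw [Finset.sum_eq_single_of_mem w hw.1, if_pos hw.2]
    intro w' hw' hne
    exact if_neg fun h => hne (huniq w' ⟨hw', h⟩)
  rw [h1, Finset.sum_comm]
  refine Finset.sum_congr rfl fun w hw => ?_
  rw [← Finset.sum_filter, hafnian, Finset.mul_sum]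
  refine Finset.sum_bij' (fun E _ => E.erase s(u, w)) (fun E _ => insert s(u, w) E)
    ?_ ?_ ?_ ?_ ?_
  · intro E hE
    obtain ⟨hE, huw⟩ := Finset.mem_filter.mp hE
    exact mem_perfectMatchings.mpr ((mem_perfectMatchings.mp hE).erase_edge huw)
  · intro E hE
    exact Finset.mem_filter.mpr ⟨mem_perfectMatchings.mpr
      ((mem_perfectMatchings.mp hE).insert_edge hu hw), Finset.mem_insert_self _ _⟩
  · intro E hE
    exact Finset.insert_erase (Finset.mem_filter.mp hE).2
  · intro E hE
    exact Finset.erase_insert (mem_perfectMatchings.mp hE).notMem_of_erase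
  · intro E hE
    exact (Finset.mul_prod_erase E W (Finset.mem_filter.mp hE).2).symm

end Hafnian

/-! ### Wick's theorem -/

section Wick

variable {n : ℕ} {A : Type*} [Ring A] (cr an : Vertex n → A)

/-- The normal ordered product of the field operators `cr v + an v` over the vertices `v ∈ S` of
the `i`-th pair. -/
def normalFactor (S : Finset (Vertex n)) (i : Fin n) : A :=
  if .inl i ∈ S then
    if .inr i ∈ S then
      cr (.inl i) * cr (.inr i) + cr (.inl i) * an (.inr i) + cr (.inr i) * an (.inl i) +
        an (.inl i) * an (.inr i)
    else cr (.inl i) + an (.inl i)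
  else if .inr i ∈ S then cr (.inr i) + an (.inr i) else 1

theorem normalFactor_erase_of_ne {S : Finset (Vertex n)} {i : Fin n} {w : Vertex n}
    (hw : pairIndex w ≠ i) : normalFactor cr an (S.erase w) i = normalFactor cr an S i := by
  have h1 : Sum.inl i ≠ w := by rintro rfl; exact hw rfl
  have h2 : Sum.inr i ≠ w := by rintro rfl; exact hw rfl
  simp [normalFactor, Finset.mem_erase, h1, h2]

variable {cr an}

/-- In a normal ordered product the creation part of any chosen vertex can be brought to the far
left and its annihilation part to the far right, since operators of the same kind commute. -/
theorem normalFactor_eq_of_mem (hcr : ∀ u v, cr u * cr v = cr v * cr u)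
    (han : ∀ u v, an u * an v = an v * an u) {S : Finset (Vertex n)} {u : Vertex n} (hu : u ∈ S) :
    normalFactor cr an S (pairIndex u) =
      cr u * normalFactor cr an (S.erase u) (pairIndex u) +
        normalFactor cr an (S.erase u) (pairIndex u) * an u := by
  rcases u with i | i
  · by_cases h2 : Sum.inr i ∈ S
    · simp only [normalFactor, pairIndex, Sum.elim_inl, id, hu, h2, Finset.mem_erase, ne_eq,
        not_true_eq_false, false_and, if_true, if_false, reduceCtorEq, not_false_eq_true, and_self]
      rw [han (.inl i)]
      noncomm_ring
    · simp [normalFactor, pairIndex, hu, h2]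
  · by_cases h2 : Sum.inl i ∈ S
    · simp only [normalFactor, pairIndex, Sum.elim_inr, id, hu, h2, Finset.mem_erase, ne_eq,
        not_true_eq_false, false_and, if_true, if_false, reduceCtorEq, not_false_eq_true, and_self]
      rw [hcr (.inl i)]
      noncomm_ring
    · simp [normalFactor, pairIndex, hu, h2]

theorem prod_normalFactor_erase {S : Finset (Vertex n)} {w : Vertex n} {is : List (Fin n)}
    (hw : pairIndex w ∉ is) :
    (is.map (normalFactor cr an (S.erase w))).prod = (is.map (normalFactor cr an S)).prod := by
  congr 1
  refine List.map_congr_left fun i hi => normalFactor_erase_of_ne cr an ?_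
  rintro rfl
  exact hw hi

variable [Algebra ℂ A] {κ : Vertex n → Vertex n → ℂ}

/-- The commutator with `an u` is a derivation that kills annihilation operators and sends `cr w` to
the scalar `κ u w`. On a normal ordered factor it therefore deletes one vertex at a time. -/
theorem an_mul_normalFactor (han : ∀ u v, an u * an v = an v * an u)
    (hκ : ∀ u v, an u * cr v = cr v * an u + κ u v • 1) (S : Finset (Vertex n)) (u : Vertex n)
    (i : Fin n) :
    an u * normalFactor cr an S i = normalFactor cr an S i * an u +
      ∑ w ∈ S with pairIndex w = i, κ u w • normalFactor cr an (S.erase w) i := by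
  have hfilter : S.filter (fun w => pairIndex w = i) = ({.inl i, .inr i} : Finset _) ∩ S := by
    ext w
    simp only [Finset.mem_filter, Finset.mem_inter, Finset.mem_insert, Finset.mem_singleton]
    rcases w with j | j <;> simp [pairIndex, and_comm]
  rw [hfilter]
  by_cases h1 : Sum.inl i ∈ S <;> by_cases h2 : Sum.inr i ∈ S
  · rw [Finset.inter_eq_left.mpr (by simp [Finset.insert_subset_iff, h1, h2]),
      Finset.sum_pair (by simp)]
    simp only [normalFactor, h1, h2, Finset.mem_erase, ne_eq,
        not_true_eq_false, false_and, if_true, if_false, reduceCtorEq, not_false_eq_true, and_self]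
    have e1 : an u * (cr (.inl i) * cr (.inr i)) = cr (.inl i) * cr (.inr i) * an u +
        κ u (.inl i) • cr (.inr i) + κ u (.inr i) • cr (.inl i) := by
      rw [← mul_assoc, hκ, add_mul, mul_assoc, hκ, mul_add, ← mul_assoc]
      simp only [smul_mul_assoc, mul_smul_comm, one_mul, mul_one]
      abel
    have e2 : ∀ v w, an u * (cr v * an w) = cr v * an w * an u + κ u v • an w := by
      intro v w
      rw [← mul_assoc, hκ, add_mul, mul_assoc, han u, ← mul_assoc]
      simp
    have e3 : an u * (an (.inl i) * an (.inr i)) = an (.inl i) * an (.inr i) * an u := by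
      rw [← mul_assoc, han u, mul_assoc, han u, mul_assoc]
    rw [mul_add, mul_add, mul_add, e1, e2, e2, e3]
    simp only [add_mul, smul_add]
    abel
  · have : ({.inl i, .inr i} : Finset (Vertex n)) ∩ S = {.inl i} := by
      ext w; rcases w with j | j <;> simp <;> grind
    rw [this, Finset.sum_singleton]
    simp [normalFactor, h1, h2, mul_add, add_mul, hκ, han u]
    abel
  · have : ({.inl i, .inr i} : Finset (Vertex n)) ∩ S = {.inr i} := by
      ext w; rcases w with j | j <;> simp <;> grind
    rw [this, Finset.sum_singleton]
    simp [normalFactor, h1, h2, mul_add, add_mul, hκ, han u]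
    abel
  · have : ({.inl i, .inr i} : Finset (Vertex n)) ∩ S = ∅ := by
      ext w; rcases w with j | j <;> simp <;> grind
    simp [this, normalFactor, h1, h2]

/-- The Leibniz rule over the factors. Absence of repetitions ensures that deleting `w` changes only
one factor, so each summand is again a product of the same shape. -/
theorem an_mul_prod_normalFactor (han : ∀ u v, an u * an v = an v * an u)
    (hκ : ∀ u v, an u * cr v = cr v * an u + κ u v • 1) (S : Finset (Vertex n)) (u : Vertex n)
    {is : List (Fin n)} (his : is.Nodup) :
    an u * (is.map (normalFactor cr an S)).prod = (is.map (normalFactor cr an S)).prod * an u +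
      ∑ w ∈ S with pairIndex w ∈ is,
        κ u w • (is.map (normalFactor cr an (S.erase w))).prod := by
  induction is with
  | nil => simp
  | cons i is ih =>
    obtain ⟨hi, his⟩ := List.nodup_cons.mp his
    have hsplit : S.filter (fun w => pairIndex w ∈ i :: is) =
        S.filter (fun w => pairIndex w = i) ∪ S.filter (fun w => pairIndex w ∈ is) := by
      ext w
      simp only [List.mem_cons, Finset.mem_filter, Finset.mem_union]
      tauto
    have hdisj : Disjoint (S.filter (fun w => pairIndex w = i))
        (S.filter (fun w => pairIndex w ∈ is)) := by
      refine Finset.disjoint_filter.mpr ?_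
      rintro w _ rfl
      exact hi
    rw [hsplit, Finset.sum_union hdisj, List.map_cons, List.prod_cons, ← mul_assoc,
      an_mul_normalFactor han hκ, add_mul, mul_assoc, ih his, mul_add, Finset.sum_mul,
      Finset.mul_sum, mul_assoc]
    have e1 : ∀ w ∈ S.filter (fun w => pairIndex w = i),
        κ u w • normalFactor cr an (S.erase w) i * (is.map (normalFactor cr an S)).prod =
        κ u w • ((i :: is).map (normalFactor cr an (S.erase w))).prod := by
      intro w hw
      have hwi := (Finset.mem_filter.mp hw).2
      rw [List.map_cons, List.prod_cons, prod_normalFactor_erase (by rwa [hwi]), smul_mul_assoc]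
    have e2 : ∀ w ∈ S.filter (fun w => pairIndex w ∈ is),
        normalFactor cr an S i * κ u w • (is.map (normalFactor cr an (S.erase w))).prod =
        κ u w • ((i :: is).map (normalFactor cr an (S.erase w))).prod := by
      intro w hw
      have hwi : pairIndex w ≠ i := by
        rintro rfl
        exact hi (Finset.mem_filter.mp hw).2
      rw [List.map_cons, List.prod_cons, normalFactor_erase_of_ne cr an hwi, mul_smul_comm]
    rw [Finset.sum_congr rfl e1, Finset.sum_congr rfl e2]
    abel

/-- Wick's theorem for a product of normal ordered products of at most two operators. -/
theorem vacuum_expectation_eq_hafnian (hcr : ∀ u v, cr u * cr v = cr v * cr u)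
    (han : ∀ u v, an u * an v = an v * an u)
    (hκ : ∀ u v, an u * cr v = cr v * an u + κ u v • 1) (φ : A →ₗ[ℂ] ℂ) (h1 : φ 1 = 1)
    (hφcr : ∀ u x, φ (cr u * x) = 0) (hφan : ∀ u x, φ (x * an u) = 0) {W : Sym2 (Vertex n) → ℂ}
    (hW : ∀ u v, pairIndex u < pairIndex v → W s(u, v) = κ u v)
    (hW' : ∀ u v, pairIndex u = pairIndex v → W s(u, v) = 0) (S : Finset (Vertex n))
    {is : List (Fin n)} (his : is.Pairwise (· < ·)) (hS : ∀ v ∈ S, pairIndex v ∈ is) :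
    φ (is.map (normalFactor cr an S)).prod = hafnian W S := by
  induction hc : S.card using Nat.strong_induction_on generalizing S is with
  | _ c ihc =>
  subst hc
  induction is with
  | nil =>
    have : S = ∅ := Finset.eq_empty_of_forall_notMem fun v hv => by simpa using hS v hv
    simp [this, h1, hafnian_empty]
  | cons i is ih =>
    obtain ⟨hlt, his'⟩ := List.pairwise_cons.mp his
    have hnodup : (i :: is).Nodup := his.imp fun h => h.ne
    by_cases hex : ∃ u ∈ S, pairIndex u = i
    -- For `u` in the leftmost pair, `φ` kills the creation part. The annihilation part travels to
    -- the right end, where `φ` kills it too, leaving its contractions with later pairs. These match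
    -- the expansion of the hafnian at `u`, and the induction on the size of `S` applies with the
    -- list of pairs unchanged.
    · obtain ⟨u, hu, rfl⟩ := hex
      rw [List.map_cons, List.prod_cons, normalFactor_eq_of_mem hcr han hu, add_mul, map_add,
        mul_assoc, hφcr, zero_add, mul_assoc,
        an_mul_prod_normalFactor han hκ S u (List.nodup_cons.mp hnodup).2, mul_add, map_add,
        ← mul_assoc, hφan, zero_add, Finset.mul_sum, map_sum, hafnian_eq_sum_erase W hu]
      have hsub : S.filter (fun w => pairIndex w ∈ is) ⊆ S.erase u := by
        intro w hw
        obtain ⟨hwS, hw⟩ := Finset.mem_filter.mp hw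
        refine Finset.mem_erase.mpr ⟨?_, hwS⟩
        rintro rfl
        exact (List.nodup_cons.mp hnodup).1 hw
      -- The hafnian expansion also pairs `u` with its partner in the same pair; that term has
      -- weight zero by `hW'`.
      rw [← Finset.sum_subset hsub]
      · refine Finset.sum_congr rfl fun w hw => ?_
        have hwu := hsub hw
        obtain ⟨hwS, hw⟩ := Finset.mem_filter.mp hw
        have hlt' := hlt _ hw
        rw [hW u w hlt', mul_smul_comm, map_smul, smul_eq_mul]
        congr 1
        rw [← ihc ((S.erase u).erase w).card ?_ ((S.erase u).erase w) his ?_ rfl]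
        · rw [List.map_cons, List.prod_cons, normalFactor_erase_of_ne cr an hlt'.ne',
            Finset.erase_right_comm, prod_normalFactor_erase (List.nodup_cons.mp hnodup).1]
        · exact (Finset.card_lt_card (Finset.erase_ssubset hwu)).trans
            (Finset.card_lt_card (Finset.erase_ssubset hu))
        · intro v hv
          exact hS v (Finset.mem_of_mem_erase (Finset.mem_of_mem_erase hv))
      · intro w hw hw'
        have hwS := Finset.mem_of_mem_erase hw
        have := hS w hwS
        rw [List.mem_cons] at this
        rw [hW' u w, zero_mul]
        rcases this with h | h
        · exact h.symm
        · exact absurd (Finset.mem_filter.mpr ⟨hwS, h⟩) hw'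
    · push Not at hex
      have hone : normalFactor cr an S i = 1 := by
        have h1 : Sum.inl i ∉ S := fun h => hex _ h rfl
        have h2 : Sum.inr i ∉ S := fun h => hex _ h rfl
        simp [normalFactor, h1, h2]
      rw [List.map_cons, List.prod_cons, hone, one_mul]
      refine ih his' fun v hv => ?_
      have := hS v hv
      rw [List.mem_cons] at this
      exact this.resolve_left (hex v hv)

end Wick

/-! ### Diagrams -/

/-- A count: `n` disjoint edges without loops cover `2n` vertices, which is all of them. -/
theorem IsDiagram.isPerfectMatching {n : ℕ} {E : Finset (Sym2 (Vertex n))} (hE : IsDiagram E) :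
    IsPerfectMatching Finset.univ E := by
  have hdiag : ∀ e ∈ E, ¬e.IsDiag := by
    intro e he hd
    obtain ⟨v, rfl⟩ : ∃ v, e = s(v, v) := by
      induction e with
      | h u v => exact ⟨v, by rw [Sym2.mk_isDiag_iff.mp hd]⟩
    rcases v with i | i
    · exact (hE.not_within_pair i).2.1 he
    · exact (hE.not_within_pair i).2.2 he
  have hdisj : ∀ e ∈ E, ∀ f ∈ E, ∀ v : Vertex n, v ∈ e → v ∈ f → e = f := by
    intro e he f hf v hve hvf
    by_contra hne
    exact hE.disjoint e he f hf hne v hve hvf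
  have hcov : IsPerfectMatching (E.biUnion Sym2.toFinset) E :=
    ⟨hdiag, hdisj, fun v => by simp⟩
  have hcard := card_eq_two_mul_card hcov
  have huniv : E.biUnion Sym2.toFinset = Finset.univ := by
    refine Finset.eq_univ_of_card _ ?_
    rw [hcard, hE.card_eq, Fintype.card_sum, Fintype.card_fin, two_mul]
  rwa [huniv] at hcov

/-- The perfect matchings that are not diagrams are those with an edge inside a pair, and their
weight vanishes. -/
theorem hafnian_univ_eq_sum_diagrams {n : ℕ} {W : Sym2 (Vertex n) → ℂ}
    (hW : ∀ u v, pairIndex u = pairIndex v → W s(u, v) = 0) :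
    hafnian W Finset.univ = ∑ D ∈ diagrams n, ∏ e ∈ D, W e := by
  have hmem : ∀ {D : Finset (Sym2 (Vertex n))}, D ∈ diagrams n ↔ IsDiagram D := by
    simp [diagrams]
  refine (Finset.sum_subset (fun D hD => mem_perfectMatchings.mpr
    (hmem.mp hD).isPerfectMatching) fun E hE hE' => ?_).symm
  have hE := mem_perfectMatchings.mp hE
  by_contra hne
  refine hE' (hmem.mpr ⟨?_, fun i => ⟨fun h => ?_, fun h => ?_, fun h => ?_⟩, ?_⟩)
  · have := card_eq_two_mul_card hE
    rw [Finset.card_univ, Fintype.card_sum, Fintype.card_fin] at this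
    lia
  · exact hne (Finset.prod_eq_zero h (hW _ _ rfl))
  · exact hne (Finset.prod_eq_zero h (hW _ _ rfl))
  · exact hne (Finset.prod_eq_zero h (hW _ _ rfl))
  · intro e he f hf hef v hve hvf
    exact hef (hE.eq_of_mem e he f hf v hve hvf)

/-- The indicator of the edges that join two pairs of the same colour. -/
def sameColor {n : ℕ} {C : Type*} [DecidableEq C] (j : Fin n → C) : Sym2 (Vertex n) → ℂ :=
  Sym2.lift ⟨fun u v => if j (pairIndex u) = j (pairIndex v) then 1 else 0, fun u v => by
    simp only [eq_comm]⟩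

theorem sameColor_mk {n : ℕ} {C : Type*} [DecidableEq C] (j : Fin n → C) (u v : Vertex n) :
    sameColor j s(u, v) = if j (pairIndex u) = j (pairIndex v) then 1 else 0 := rfl

/-- The number of colourings of the pairs that are constant on the cycles of a diagram. -/
theorem sum_prod_sameColor {n N : ℕ} (E : Finset (Sym2 (Vertex n))) :
    ∑ j : Fin n → Fin N, ∏ e ∈ E, sameColor j e = (N : ℂ) ^ cycleCount E := by
  classical
  -- The product is the indicator of the colourings that are constant along adjacency in `pairGraph
  -- E`. An edge inside a pair contributes the factor `1` and no adjacency.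
  have hadj : ∀ j : Fin n → Fin N, (∏ e ∈ E, sameColor j e) =
      if ∀ i i', (pairGraph E).Adj i i' → j i = j i' then 1 else 0 := by
    intro j
    split_ifs with hj
    · refine Finset.prod_eq_one fun e he => ?_
      induction e with
      | h u v =>
        rw [sameColor_mk, if_pos]
        by_cases huv : pairIndex u = pairIndex v
        · rw [huv]
        · exact hj _ _ ((SimpleGraph.fromRel_adj _ _ _).mpr ⟨huv, Or.inl ⟨u, v, rfl, rfl, he⟩⟩)
    · push Not at hj
      obtain ⟨i, i', hadj, hne⟩ := hj
      obtain ⟨-, ⟨u, v, rfl, rfl, he⟩ | ⟨u, v, rfl, rfl, he⟩⟩ :=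
        (SimpleGraph.fromRel_adj _ _ _).mp hadj
      · exact Finset.prod_eq_zero he (by rw [sameColor_mk, if_neg hne])
      · exact Finset.prod_eq_zero he (by rw [sameColor_mk, if_neg hne.symm])
  simp_rw [hadj]
  rw [Finset.sum_boole]
  -- Such colourings are the functions on connected components, which is how the number of cycles
  -- becomes an exponent.
  have hequiv : {j : Fin n → Fin N // ∀ i i', (pairGraph E).Adj i i' → j i = j i'} ≃
      ((pairGraph E).ConnectedComponent → Fin N) :=
    { toFun := fun j c => c.lift j.1 (fun v w p _ => by
        induction p with
        | nil => rfl
        | cons hadj _ ih => exact (j.2 _ _ hadj).trans (ih (by simp_all)))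
      invFun := fun g => ⟨fun i => g ((pairGraph E).connectedComponentMk i), fun i i' hii => by
        exact congrArg g (SimpleGraph.ConnectedComponent.sound hii.reachable)⟩
      left_inv := fun j => rfl
      right_inv := fun g => by
        funext c
        induction c using SimpleGraph.ConnectedComponent.ind with
        | h v => rfl }
  have hc := Nat.card_congr hequiv
  rw [Nat.card_fun, Nat.card_eq_fintype_card, Fintype.card_subtype, Nat.card_fin] at hc
  rw [hc, cycleCount, Nat.cast_pow]

/-! ### The Fock representation with several colours -/

section Fock

variable {h : Type*} [AddCommGroup h] [Module ℂ h] (β : LinearMap.BilinForm ℂ h) (hβ : β.IsSymm)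

/-- The contraction `(a t^m, b t^n) ↦ m (a, b) δ_{m+n,0}` for `m ≥ 0` and `0` for `m < 0`. -/
def contraction : LinearMap.BilinForm ℂ (ℤ →₀ h) :=
  Finsupp.lsum ℂ fun m : ℤ =>
    (if 0 ≤ m then (m : ℂ) else 0) • β.compl₂ (Finsupp.lapply (-m))

theorem contraction_single (m n : ℤ) (a b : h) :
    contraction β (Finsupp.single m a) (Finsupp.single n b) =
      if 0 ≤ m ∧ m + n = 0 then (m : ℂ) * β a b else 0 := by
  by_cases hmn : m + n = 0
  · have : n = -m := by lia
    by_cases hm : 0 ≤ m <;> simp [contraction, this, hm]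
  · have : n ≠ -m := by lia
    by_cases hm : 0 ≤ m <;> simp [contraction, hmn, this, hm]

/-- Only one of two opposite nonzero modes contracts with the other on its right, and mode `0` has
coefficient `0`. Hence the contraction is one half of the splitting of the Heisenberg form, and it
produces the correct commutator in `fockOp_comm`. -/
theorem contraction_sub_swap (hβ : β.IsSymm) (x y : ℤ →₀ h) :
    contraction β x y - contraction β y x = modeForm β x y := by
  induction x using Finsupp.induction_linear with
  | zero => simp
  | add x x' hx hx' =>
    simp only [map_add, LinearMap.add_apply, ← hx, ← hx']
    ring
  | single m a =>
    induction y using Finsupp.induction_linear with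
    | zero => simp
    | add y y' hy hy' =>
      simp only [map_add, LinearMap.add_apply, ← hy, ← hy']
      ring
    | single n b =>
      rw [contraction_single, contraction_single, modeForm_single, add_comm n m]
      by_cases hmn : m + n = 0
      · obtain rfl : n = -m := by lia
        rcases lt_trichotomy m 0 with hm | rfl | hm
        · simp [hm.not_ge, hm.le, hβ.eq b a]
        · simp
        · simp [hm.le, hm.not_ge]
      · simp [hmn]

/-- The projection to the span of the `a t^m` with `m < 0`. -/
def negPart : (ℤ →₀ h) →ₗ[ℂ] (ℤ →₀ h) :=
  Finsupp.lsum ℂ fun m : ℤ => if m < 0 then Finsupp.lsingle m else 0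

theorem negPart_single_of_neg {m : ℤ} (hm : m < 0) (a : h) :
    negPart (Finsupp.single m a) = Finsupp.single m a := by
  simp [negPart, hm]

theorem negPart_single_of_nonneg {m : ℤ} (hm : 0 ≤ m) (a : h) :
    negPart (Finsupp.single m a) = 0 := by
  simp [negPart, hm.not_gt]

/-- A contraction with a nonnegative mode on the right could only pair mode `0` with mode `0`, where
the coefficient is `0`. -/
theorem contraction_negPart (x y : ℤ →₀ h) : contraction β x (negPart y) = contraction β x y := by
  induction y using Finsupp.induction_linear with
  | zero => simp
  | add y y' hy hy' => rw [map_add, map_add, map_add, hy, hy']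
  | single n b =>
    rcases lt_or_ge n 0 with hn | hn
    · rw [negPart_single_of_neg hn]
    · rw [negPart_single_of_nonneg hn, map_zero]
      induction x using Finsupp.induction_linear with
      | zero => simp
      | add x x' hx hx' => rw [map_add, LinearMap.add_apply, ← hx, ← hx', add_zero]
      | single m a =>
        rw [contraction_single]
        split_ifs with hm
        · obtain rfl : m = 0 := by lia
          simp
        · rfl

/-! ### Creation and annihilation operators with colours -/

variable (C : Type*)

/-- Polynomials in variables indexed by a basis of `L(𝔥)` and a set of colours. -/
abbrev FockRep (h : Type*) [AddCommGroup h] [Module ℂ h] (C : Type*) : Type _ :=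
  MvPolynomial (Module.Basis.ofVectorSpaceIndex ℂ (ℤ →₀ h) × C) ℂ

variable {C}

/-- The linear polynomial of colour `j` of an element of `L(𝔥)`. -/
def fockLin (j : C) : (ℤ →₀ h) →ₗ[ℂ] FockRep h C :=
  Finsupp.linearCombination ℂ (fun i => MvPolynomial.X (i, j)) ∘ₗ
    (loopBasis h).repr.toLinearMap

theorem fockLin_basis (j : C) (i : Module.Basis.ofVectorSpaceIndex ℂ (ℤ →₀ h)) :
    fockLin j (loopBasis h i) = MvPolynomial.X (i, j) := by
  simp [fockLin]

/-- The creation operator of colour `j`: multiplication by the linear polynomial of the negative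
part. -/
def creation (j : C) : (ℤ →₀ h) →ₗ[ℂ] Module.End ℂ (FockRep h C) :=
  LinearMap.mul ℂ (FockRep h C) ∘ₗ fockLin j ∘ₗ negPart

theorem creation_apply (j : C) (x : ℤ →₀ h) (p : FockRep h C) :
    creation j x p = fockLin j (negPart x) * p := rfl

open scoped Classical in
/-- The annihilation operator of colour `j`: the derivation that contracts with an element of
`L(𝔥)`. -/
def annihilation (j : C) : (ℤ →₀ h) →ₗ[ℂ] Module.End ℂ (FockRep h C) where
  toFun x := (MvPolynomial.mkDerivation ℂ fun i =>
    MvPolynomial.C (if j = i.2 then contraction β x (loopBasis h i.1) else 0) :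
      Derivation ℂ (FockRep h C) (FockRep h C))
  map_add' x y := by
    rw [← Derivation.coe_add_linearMap]
    congr 1
    ext i
    by_cases hj : j = i.2 <;> simp [hj]
  map_smul' t x := by
    rw [RingHom.id_apply, ← Derivation.coe_smul_linearMap]
    congr 1
    ext i
    by_cases hj : j = i.2 <;> simp [hj, MvPolynomial.smul_eq_C_mul]

theorem annihilation_mul (j : C) (x : ℤ →₀ h) (p q : FockRep h C) :
    annihilation β j x (p * q) = p * annihilation β j x q + q * annihilation β j x p := by
  simp [annihilation]

theorem annihilation_C (j : C) (x : ℤ →₀ h) (t : ℂ) :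
    annihilation β j x (MvPolynomial.C t) = 0 := by
  simp [annihilation]

theorem annihilation_one (j : C) (x : ℤ →₀ h) : annihilation β j x 1 = 0 := by
  simp [annihilation]

open scoped Classical in
theorem annihilation_X (j : C) (x : ℤ →₀ h)
    (i : Module.Basis.ofVectorSpaceIndex ℂ (ℤ →₀ h) × C) :
    annihilation β j x (MvPolynomial.X i) =
      MvPolynomial.C (if j = i.2 then contraction β x (loopBasis h i.1) else 0) := by
  simp [annihilation]

open scoped Classical in
theorem annihilation_lin (j k : C) (x y : ℤ →₀ h) :
    annihilation β j x (fockLin k y) =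
      MvPolynomial.C (if j = k then contraction β x y else 0) := by
  have : (annihilation β j x ∘ₗ fockLin k) = (Algebra.linearMap ℂ (FockRep h C)) ∘ₗ
      (if j = k then contraction β x else 0) := by
    refine (loopBasis h).ext fun i => ?_
    by_cases hj : j = k <;>
      simp [annihilation_X, fockLin_basis, MvPolynomial.algebraMap_eq, hj]
  have := LinearMap.congr_fun this y
  by_cases hj : j = k
  · simpa [hj, MvPolynomial.algebraMap_eq] using this
  · simpa [hj] using this

theorem creation_comm (j k : C) (x y : ℤ →₀ h) :
    creation j x * creation k y = creation k y * creation j x := by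
  refine LinearMap.ext fun p => ?_
  simp only [Module.End.mul_apply, creation_apply]
  ring

theorem annihilation_comm (j k : C) (x y : ℤ →₀ h) :
    annihilation β j x * annihilation β k y = annihilation β k y * annihilation β j x := by
  refine LinearMap.ext fun p => ?_
  rw [Module.End.mul_apply, Module.End.mul_apply]
  induction p using MvPolynomial.induction_on with
  | C a => simp only [annihilation_C, map_zero]
  | add p q hp hq => rw [map_add, map_add, map_add, map_add, hp, hq]
  | mul_X p i hp =>
    simp only [annihilation_mul, map_add, annihilation_X, annihilation_C, hp]
    ring

open scoped Classical in
-- The canonical commutation relation: a derivation applied to a product with a linear polynomial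
-- gives the contraction as a constant, and nothing when the colours differ.
theorem annihilation_mul_creation (j k : C) (x y : ℤ →₀ h) :
    annihilation β j x * creation k y = creation k y * annihilation β j x +
      (if j = k then contraction β x y else 0) • 1 := by
  refine LinearMap.ext fun p => ?_
  simp only [Module.End.mul_apply, LinearMap.add_apply, creation_apply, annihilation_mul,
    annihilation_lin, contraction_negPart, LinearMap.smul_apply, Module.End.one_apply,
    MvPolynomial.smul_eq_C_mul]
  ring

theorem creation_single_of_nonneg (j : C) {m : ℤ} (hm : 0 ≤ m) (a : h) :
    creation j (Finsupp.single m a) = 0 := by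
  refine LinearMap.ext fun p => ?_
  simp [creation_apply, negPart_single_of_nonneg hm]

theorem annihilation_single_of_neg (j : C) {m : ℤ} (hm : m < 0) (a : h) :
    annihilation β j (Finsupp.single m a) = 0 := by
  have h0 : contraction β (Finsupp.single m a) = 0 := by
    simp [contraction, hm.not_ge]
  refine LinearMap.ext fun p => ?_
  induction p using MvPolynomial.induction_on with
  | C t => simp [annihilation_C]
  | add p q hp hq => rw [map_add, hp, hq, map_add]
  | mul_X p i hp => simp [annihilation_mul, annihilation_X, h0, hp]

/-- The action of colour `j` of an element of `L(𝔥)`. -/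
def fockOp (j : C) : (ℤ →₀ h) →ₗ[ℂ] Module.End ℂ (FockRep h C) :=
  creation j + annihilation β j

theorem fockOp_apply (j : C) (x : ℤ →₀ h) :
    fockOp β j x = creation j x + annihilation β j x := rfl

theorem fockOp_comm (hβ : β.IsSymm) (j : C) (x y : ℤ →₀ h) :
    fockOp β j x * fockOp β j y - fockOp β j y * fockOp β j x = modeForm β x y • 1 := by
  have e1 := annihilation_mul_creation β j j x y
  have e2 := annihilation_mul_creation β j j y x
  rw [if_pos rfl] at e1 e2
  have e3 : modeForm β x y • (1 : Module.End ℂ (FockRep h C)) =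
      contraction β x y • 1 - contraction β y x • 1 := by
    rw [← contraction_sub_swap β hβ x y]
    exact sub_smul (contraction β x y) (contraction β y x) (1 : Module.End ℂ (FockRep h C))
  rw [e3]
  simp only [fockOp_apply, mul_add, add_mul, e1, e2, creation_comm j j x y,
    annihilation_comm β j j x y]
  abel

theorem fockOp_commute {j k : C} (hjk : j ≠ k) (x y : ℤ →₀ h) :
    Commute (fockOp β j x) (fockOp β k y) := by
  have e1 := annihilation_mul_creation β j k x y
  have e2 := annihilation_mul_creation β k j y x
  rw [if_neg hjk, zero_smul, add_zero] at e1
  rw [if_neg hjk.symm, zero_smul, add_zero] at e2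
  simp only [Commute, SemiconjBy, fockOp_apply, mul_add, add_mul, e1, e2, creation_comm j k x y,
    annihilation_comm β j k x y]
  abel

/-! ### The representation of `𝔏` on the Fock space -/

/-- The representation of colour `j` of the enveloping algebra, in which `c` acts as `1`. -/
def fockHom (j : C) : UHeis β hβ →ₐ[ℂ] Module.End ℂ (FockRep h C) :=
  UniversalEnvelopingAlgebra.lift ℂ
    { toLinearMap := fockOp β j ∘ₗ Heisenberg.toLoop β hβ +
        (LinearMap.toSpanSingleton ℂ (Module.End ℂ (FockRep h C)) 1) ∘ₗ
          Heisenberg.toCentral β hβ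
      map_lie' := by
        intro x y
        have := fockOp_comm β hβ j (Heisenberg.toLoop β hβ x) (Heisenberg.toLoop β hβ y)
        simp only [Heisenberg.lie_def, LieRing.of_associative_ring_bracket]
        simp [Heisenberg.toLoop_c, Heisenberg.toCentral_c, mul_add, add_mul, ← this]
        rw [smul_comm (Heisenberg.toCentral β hβ y)]
        abel }

theorem fockHom_loop (j : C) (x : ℤ →₀ h) :
    fockHom β hβ j (loop β hβ x) = fockOp β j x := by
  rw [fockHom, loop, LinearMap.comp_apply, LieHom.coe_toLinearMap,
    UniversalEnvelopingAlgebra.lift_ι_apply]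
  change fockOp β j (Heisenberg.toLoop β hβ (Heisenberg.ofLoop β hβ x)) +
    Heisenberg.toCentral β hβ (Heisenberg.ofLoop β hβ x) • (1 : Module.End ℂ (FockRep h C)) = _
  rw [Heisenberg.toLoop_ofLoop, Heisenberg.toCentral_ofLoop, zero_smul, add_zero]

theorem fockHom_central (j : C) : fockHom β hβ j (central β hβ) = 1 := by
  rw [fockHom, central, UniversalEnvelopingAlgebra.lift_ι_apply]
  change fockOp β j (Heisenberg.toLoop β hβ (Heisenberg.c β hβ)) +
    Heisenberg.toCentral β hβ (Heisenberg.c β hβ) • (1 : Module.End ℂ (FockRep h C)) = _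
  rw [Heisenberg.toLoop_c, Heisenberg.toCentral_c, map_zero, one_smul, zero_add]

theorem fockHom_commute {j k : C} (hjk : j ≠ k) {x y : UHeis β hβ} (hx : x ∈ quadSpan β hβ)
    (hy : y ∈ quadSpan β hβ) : Commute (fockHom β hβ j x) (fockHom β hβ k y) := by
  induction hx using Submodule.span_induction with
  | zero => simp
  | add x x' _ _ hx hx' => rw [map_add]; exact hx.add_left hx'
  | smul t x _ hx => rw [map_smul]; exact hx.smul_left t
  | mem x hx =>
    induction hy using Submodule.span_induction with
    | zero => simp
    | add y y' _ _ hy hy' => rw [map_add]; exact hy.add_right hy'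
    | smul t y _ hy => rw [map_smul]; exact hy.smul_right t
    | mem y hy =>
      rcases hx with ⟨a, b, m, n, rfl⟩ | rfl
      · rcases hy with ⟨a', b', m', n', rfl⟩ | rfl
        · simp only [map_mul, mode, fockHom_loop]
          exact ((fockOp_commute β hjk _ _).mul_right (fockOp_commute β hjk _ _)).mul_left
            ((fockOp_commute β hjk _ _).mul_right (fockOp_commute β hjk _ _))
        · rw [fockHom_central]
          exact Commute.one_right _
      · rw [fockHom_central]
        exact Commute.one_left _

/-- Since `c` acts as `1` in each colour, dividing the commutator by `c` has no effect there. -/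
theorem fockHom_lie (j : C) (x y : quadLie β hβ) :
    fockHom β hβ j (quadLie.toU β hβ ⁅x, y⁆) =
      fockHom β hβ j (quadLie.toU β hβ x) * fockHom β hβ j (quadLie.toU β hβ y) -
      fockHom β hβ j (quadLie.toU β hβ y) * fockHom β hβ j (quadLie.toU β hβ x) := by
  have := congrArg (fockHom β hβ j) (quadLie.central_mul_lie β hβ x y)
  simpa [fockHom_central] using this

/-- The sum of the actions of all colours, a representation of `𝔏`. -/
def fockLie (C : Type*) [Fintype C] : quadLie β hβ →ₗ⁅ℂ⁆ Module.End ℂ (FockRep h C) where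
  toLinearMap := ∑ j : C, (fockHom β hβ j).toLinearMap ∘ₗ quadLie.toU β hβ
  map_lie' := by
    intro x y
    classical
    simp only [AddHom.toFun_eq_coe, LinearMap.coe_toAddHom, LinearMap.sum_apply,
      LinearMap.comp_apply, AlgHom.toLinearMap_apply, LieRing.of_associative_ring_bracket,
      Finset.sum_mul_sum, fockHom_lie]
    -- With the indices of one double sum exchanged, the terms with two different colours cancel
    -- because they commute, and the diagonal terms are the single-colour brackets.
    rw [Finset.sum_comm (f := fun j k => fockHom β hβ j (quadLie.toU β hβ y) * _),
      ← Finset.sum_sub_distrib]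
    refine Finset.sum_congr rfl fun j _ => ?_
    rw [← Finset.sum_sub_distrib, Finset.sum_eq_single_of_mem j (Finset.mem_univ j)]
    intro k _ hk
    exact sub_eq_zero.mpr (fockHom_commute β hβ hk.symm (quadLie.toU_mem β hβ x)
      (quadLie.toU_mem β hβ y))

theorem fockLie_apply (C : Type*) [Fintype C] (x : quadLie β hβ) :
    fockLie β hβ C x = ∑ j : C, fockHom β hβ j (quadLie.toU β hβ x) := by
  change (∑ j : C, (fockHom β hβ j).toLinearMap ∘ₗ quadLie.toU β hβ) x = _
  simp

/-- The source of the level: every colour contributes `1`, so `N` colours realize `r = N`. -/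
theorem fockLie_c (C : Type*) [Fintype C] :
    fockLie β hβ C (quadLie.c β hβ) = (Fintype.card C : ℂ) • 1 := by
  rw [fockLie_apply]
  simp [quadLie.c, quadLie.toU_mk, fockHom_central, Nat.cast_smul_eq_nsmul]

/-- Ordering by mode agrees with placing creation before annihilation. The only term in the wrong
order is the annihilation part of the smaller mode times the creation part of the larger one. It
vanishes in either order: a negative mode has no annihilation part, and if the smaller mode is
nonnegative then the larger one has no creation part. -/
theorem fockHom_normalOrder (j : C) (a b : h) (m n : ℤ) :
    fockHom β hβ j (normalOrder β hβ a b m n) =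
      creation j (.single m a) * creation j (.single n b) +
      creation j (.single m a) * annihilation β j (.single n b) +
      creation j (.single n b) * annihilation β j (.single m a) +
      annihilation β j (.single m a) * annihilation β j (.single n b) := by
  have hc := creation_comm j j (.single m a) (.single n b)
  have ha := annihilation_comm β j j (.single m a) (.single n b)
  unfold normalOrder
  split_ifs with hmn
  · rw [map_mul, mode, mode, fockHom_loop, fockHom_loop, fockOp_apply, fockOp_apply, mul_add,
      add_mul, add_mul, hc, ha]
    rcases lt_or_ge n 0 with hn | hn
    · simp only [annihilation_single_of_neg β j hn, zero_mul, mul_zero, add_zero]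
    · simp only [creation_single_of_nonneg j (hn.trans hmn), zero_mul, mul_zero, add_zero,
        zero_add]
  · rw [map_mul, mode, mode, fockHom_loop, fockHom_loop, fockOp_apply, fockOp_apply, mul_add,
      add_mul, add_mul]
    rcases lt_or_ge m 0 with hm | hm
    · simp only [annihilation_single_of_neg β j hm, zero_mul, mul_zero, add_zero]
    · simp only [creation_single_of_nonneg j (hm.trans (not_le.mp hmn).le), zero_mul, mul_zero,
        add_zero, zero_add]

theorem fockLie_quadL (C : Type*) [Fintype C] (a b : h) (m n : ℤ) :
    fockLie β hβ C (quadL β hβ a b m n) =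
      (1 / 2 : ℂ) • ∑ j : C, (creation j (.single m a) * creation j (.single n b) +
        creation j (.single m a) * annihilation β j (.single n b) +
        creation j (.single n b) * annihilation β j (.single m a) +
        annihilation β j (.single m a) * annihilation β j (.single n b)) := by
  rw [quadL, map_smul, fockLie_apply]
  simp only [quadLie.toU_mk, fockHom_normalOrder]

/-! ### Vacuum expectation values -/

/-- The vacuum expectation value of an operator on the Fock space. -/
def vacuumExpectation (h : Type*) [AddCommGroup h] [Module ℂ h] (C : Type*) :
    Module.End ℂ (FockRep h C) →ₗ[ℂ] ℂ where
  toFun T := MvPolynomial.constantCoeff (T 1)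
  map_add' S T := by simp
  map_smul' t T := by simp

theorem vacuumExpectation_apply (T : Module.End ℂ (FockRep h C)) :
    vacuumExpectation h C T = MvPolynomial.constantCoeff (T 1) := rfl

theorem vacuumExpectation_one : vacuumExpectation h C 1 = 1 := by
  simp [vacuumExpectation_apply]

theorem constantCoeff_fockLin (j : C) (x : ℤ →₀ h) :
    MvPolynomial.constantCoeff (fockLin j x) = 0 := by
  have : ((MvPolynomial.aeval (R := ℂ) (fun _ => (0 : ℂ))).toLinearMap ∘ₗ
      (fockLin j : (ℤ →₀ h) →ₗ[ℂ] FockRep h C)) = 0 := by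
    refine (loopBasis h).ext fun l => ?_
    simp [fockLin_basis]
  have h' := LinearMap.congr_fun this x
  simpa [MvPolynomial.aeval_eq_eval, MvPolynomial.eval_zero'] using h'

theorem vacuumExpectation_creation_mul (j : C) (x : ℤ →₀ h) (T : Module.End ℂ (FockRep h C)) :
    vacuumExpectation h C (creation j x * T) = 0 := by
  rw [vacuumExpectation_apply, Module.End.mul_apply, creation_apply, map_mul,
    constantCoeff_fockLin, zero_mul]

theorem vacuumExpectation_mul_annihilation (j : C) (x : ℤ →₀ h)
    (T : Module.End ℂ (FockRep h C)) :
    vacuumExpectation h C (T * annihilation β j x) = 0 := by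
  rw [vacuumExpectation_apply, Module.End.mul_apply, annihilation_one, map_zero, map_zero]

/-- Two negative modes leave only products of creation operators, which give polynomials without
constant term. This makes the functional vanish in positive degree. -/
theorem vacuumExpectation_fockLie_mul [Fintype C] {a b : h} {m n : ℤ} (hm : m < 0) (hn : n < 0)
    (T : Module.End ℂ (FockRep h C)) :
    vacuumExpectation h C (fockLie β hβ C (quadL β hβ a b m n) * T) = 0 := by
  simp only [fockLie_quadL, annihilation_single_of_neg β _ hm, annihilation_single_of_neg β _ hn,
    mul_zero, add_zero, smul_mul_assoc, Finset.sum_mul, map_smul, map_sum, mul_assoc,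
    vacuumExpectation_creation_mul, Finset.sum_const_zero, smul_zero]

/-- A nonnegative mode rules out the term with two creation operators, and every other term ends in
an annihilation operator, which kills the constant polynomial `1`. This is the vanishing on `𝔅₊`. -/
theorem vacuumExpectation_mul_fockLie [Fintype C] {a b : h} {m n : ℤ} (hmn : 0 ≤ m ∨ 0 ≤ n)
    (T : Module.End ℂ (FockRep h C)) :
    vacuumExpectation h C (T * fockLie β hβ C (quadL β hβ a b m n)) = 0 := by
  have key : ∀ j : C, creation j (.single m a) * creation j (.single n b) = 0 := by
    intro j
    rcases hmn with hm | hn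
    · rw [creation_single_of_nonneg j hm, zero_mul]
    · rw [creation_single_of_nonneg j hn, mul_zero]
  simp only [fockLie_quadL, key, zero_add, mul_smul_comm, Finset.mul_sum, map_smul, map_sum,
    mul_add, map_add, ← mul_assoc, vacuumExpectation_mul_annihilation, add_zero,
    Finset.sum_const_zero, smul_zero]

theorem prod_ofFn_sum {R : Type*} [Semiring R] {n N : ℕ} (f : Fin n → Fin N → R) :
    (List.ofFn fun i => ∑ j, f i j).prod =
      ∑ J : Fin n → Fin N, (List.ofFn fun i => f i (J i)).prod := by
  induction n with
  | zero => simp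
  | succ n ih =>
    rw [List.ofFn_succ, List.prod_cons, ih, Finset.sum_mul_sum, ← Finset.sum_product',
      ← (Fin.consEquiv fun _ => Fin N).sum_comp]
    exact Finset.sum_congr rfl fun x _ => by simp [Fin.consEquiv]

theorem prod_ofFn_smul {R : Type*} [Semiring R] [Algebra ℂ R] {n : ℕ} (t : ℂ) (f : Fin n → R) :
    (List.ofFn fun i => t • f i).prod = t ^ n • (List.ofFn f).prod := by
  induction n with
  | zero => simp
  | succ n ih => rw [List.ofFn_succ, List.prod_cons, ih, List.ofFn_succ, List.prod_cons,
      smul_mul_smul_comm, pow_succ']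

/-- The vacuum expectation value of a product of the operators `L_{a,b}(m, n)`. -/
theorem vacuumExpectation_prod_quadL {n N : ℕ} (a b : Fin n → h) (k : Vertex n → ℤ) :
    vacuumExpectation h (Fin N) (List.ofFn fun i => fockLie β hβ (Fin N)
      (quadL β hβ (a i) (b i) (-k (.inl i) - 1) (-k (.inr i) - 1))).prod =
      ∑ D ∈ diagrams n, diagramCoeff β hβ N a b D k := by
  let x : Vertex n → ℤ →₀ h := fun v => .single (-k v - 1) (label a b v)
  let cr (j : Fin n → Fin N) : Vertex n → Module.End ℂ (FockRep h (Fin N)) :=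
    fun v => creation (j (pairIndex v)) (x v)
  let an (j : Fin n → Fin N) : Vertex n → Module.End ℂ (FockRep h (Fin N)) :=
    fun v => annihilation β (j (pairIndex v)) (x v)
  let κ (j : Fin n → Fin N) : Vertex n → Vertex n → ℂ :=
    fun u v => if j (pairIndex u) = j (pairIndex v) then contraction β (x u) (x v) else 0
  -- For a fixed colouring Wick's theorem applies. The factor `2` in the weight removes the `1 / 2`
  -- built into `edgeCoeff`, because a bare contraction carries no such factor.
  have hterm : ∀ j : Fin n → Fin N, vacuumExpectation h (Fin N)
      (List.ofFn fun i => normalFactor (cr j) (an j) Finset.univ i).prod =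
      ∑ D ∈ diagrams n, ∏ e ∈ D, sameColor j e * (2 * edgeCoeff β hβ a b k e) := by
    intro j
    have hW' : ∀ u v : Vertex n, pairIndex u = pairIndex v →
        sameColor j s(u, v) * (2 * edgeCoeff β hβ a b k s(u, v)) = 0 := by
      intro u v huv
      simp [edgeCoeff, huv]
    have := vacuum_expectation_eq_hafnian (cr := cr j) (an := an j) (κ := κ j)
      (fun u v => creation_comm _ _ _ _) (fun u v => annihilation_comm β _ _ _ _)
      (fun u v => by
        have := annihilation_mul_creation β (j (pairIndex u)) (j (pairIndex v)) (x u) (x v)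
        convert this)
      (vacuumExpectation h (Fin N)) vacuumExpectation_one
      (fun u T => vacuumExpectation_creation_mul _ _ T)
      (fun u T => vacuumExpectation_mul_annihilation β _ _ T)
      (W := fun e => sameColor j e * (2 * edgeCoeff β hβ a b k e))
      (fun u v huv => by
        simp only [sameColor_mk, edgeCoeff, Sym2.lift_mk, if_pos huv, κ, x, contraction_single,
          iotaCoeff]
        by_cases hj : j (pairIndex u) = j (pairIndex v)
        · rw [if_pos hj, if_pos hj]
          by_cases hk : k u + k v = -2
          · have hs : -k u - 1 + (-k v - 1) = 0 := by lia
            have hu : k u = -2 - k v := by lia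
            rcases lt_trichotomy (k v) (-1) with hlt | heq | hgt
            · rw [if_neg (by lia), if_neg (by lia)]
              simp
            -- Both modes are `0` here: the condition in the contraction holds but its coefficient
            -- is `0`, in agreement with `iotaCoeff`, which excludes the exponent `-1`.
            · rw [if_neg (by lia), if_pos (by lia), hu, heq]
              simp
            · rw [if_pos (by lia), if_pos (by lia), hu]
              push_cast
              ring
          · rw [if_neg (by lia), if_neg (by lia)]
            simp
        · rw [if_neg hj, if_neg hj, zero_mul])
      hW' Finset.univ (List.pairwise_lt_finRange n) (fun v _ => List.mem_finRange _)
    rw [List.ofFn_eq_map, this, hafnian_univ_eq_sum_diagrams hW']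
  -- Each pair chooses its colour independently, so the product of sums is a sum over colourings.
  -- The halves from the `n` operators collect into `(1 / 2) ^ n`, which later cancels the `2 ^ n`
  -- coming from the `n` edges.
  have hexp : (List.ofFn fun i => fockLie β hβ (Fin N)
      (quadL β hβ (a i) (b i) (-k (.inl i) - 1) (-k (.inr i) - 1))).prod =
      (1 / 2 : ℂ) ^ n • ∑ j : Fin n → Fin N,
        (List.ofFn fun i => normalFactor (cr j) (an j) Finset.univ i).prod := by
    simp only [fockLie_quadL, prod_ofFn_smul, prod_ofFn_sum]
    simp only [normalFactor, Finset.mem_univ, if_true]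
    rfl
  rw [hexp, map_smul, map_sum, Finset.sum_congr rfl fun j _ => hterm j, Finset.sum_comm,
    smul_eq_mul, Finset.mul_sum]
  refine Finset.sum_congr rfl fun D hD => ?_
  have hcard : D.card = n := by
    have : IsDiagram D := by simpa [diagrams] using hD
    exact this.card_eq
  simp only [Finset.prod_mul_distrib, Finset.prod_const, hcard, ← Finset.sum_mul,
    sum_prod_sameColor, diagramCoeff]
  rw [show (1 / 2 : ℂ) ^ n * ((N : ℂ) ^ cycleCount D * (2 ^ n * ∏ e ∈ D, edgeCoeff β hβ a b k e)) =
    ((1 / 2 : ℂ) * 2) ^ n * ((N : ℂ) ^ cycleCount D * ∏ e ∈ D, edgeCoeff β hβ a b k e) by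
      rw [mul_pow]; ring]
  norm_num

end Fock

/-! ### The functional `1'` on the enveloping algebra -/

/-- A subspace of an enveloping algebra that contains `1` and is stable under left multiplication
by the Lie algebra is everything. -/
theorem envelopingAlgebra_eq_top {L : Type*} [LieRing L] [LieAlgebra ℂ L]
    {M : Submodule ℂ (UniversalEnvelopingAlgebra ℂ L)} (h1 : 1 ∈ M)
    (hM : ∀ x : L, ∀ u ∈ M, UniversalEnvelopingAlgebra.ι ℂ x * u ∈ M) : M = ⊤ := by
  -- The elements that preserve `M` form a subalgebra containing the image of `L`. By the universal
  -- property the identity factors through it, so it is everything, and applying its elements to `1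
  -- ∈ M` gives the claim.
  let S : Subalgebra ℂ (UniversalEnvelopingAlgebra ℂ L) :=
    { carrier := {u | ∀ v ∈ M, u * v ∈ M}
      mul_mem' := fun {u u'} hu hu' v hv => by rw [mul_assoc]; exact hu _ (hu' v hv)
      add_mem' := fun {u u'} hu hu' v hv => by rw [add_mul]; exact add_mem (hu v hv) (hu' v hv)
      algebraMap_mem' := fun t v hv => by
        rw [← Algebra.smul_def]
        exact M.smul_mem t hv }
  let f : L →ₗ⁅ℂ⁆ S :=
    { toLinearMap := (UniversalEnvelopingAlgebra.ι ℂ : L →ₗ⁅ℂ⁆ _).toLinearMap.codRestrict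
        (Subalgebra.toSubmodule S) hM
      map_lie' := fun {x y} => Subtype.ext (LieHom.map_lie _ x y) }
  have hid : S.val.comp (UniversalEnvelopingAlgebra.lift ℂ f) = AlgHom.id ℂ _ := by
    ext x
    simp only [LieHom.comp_apply, AlgHom.coe_toLieHom, AlgHom.comp_apply,
      UniversalEnvelopingAlgebra.lift_ι_apply, AlgHom.id_apply]
    rfl
  refine Submodule.eq_top_iff'.mpr fun u => ?_
  have hu : u ∈ S := by
    have := AlgHom.congr_fun hid u
    rw [AlgHom.id_apply] at this
    rw [← this]
    exact (UniversalEnvelopingAlgebra.lift ℂ f u).2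
  simpa using hu 1 h1

section Functional

variable {h : Type*} [AddCommGroup h] [Module ℂ h] (β : LinearMap.BilinForm ℂ h) (hβ : β.IsSymm)

theorem mem_span_quadL (x : quadLie β hβ) :
    x ∈ Submodule.span ℂ ({x | ∃ (a b : h) (m n : ℤ), x = quadL β hβ a b m n} ∪
      {quadLie.c β hβ}) := by
  set T := Submodule.span ℂ ({x | ∃ (a b : h) (m n : ℤ), x = quadL β hβ a b m n} ∪
      {quadLie.c β hβ}) with hT
  have key : ∀ u (hu : u ∈ quadSpan β hβ), quadLie.mk β hβ u hu ∈ T := by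
    intro u hu
    induction hu using Submodule.span_induction with
    | zero => exact zero_mem T
    | add u v hu hv iu iv => exact add_mem iu iv
    | smul t u hu iu => exact T.smul_mem t iu
    | mem u hu' =>
      rcases hu' with ⟨a, b, m, n, rfl⟩ | rfl
      · have hL : quadL β hβ a b m n ∈ T := Submodule.subset_span (Or.inl ⟨a, b, m, n, rfl⟩)
        have hc : quadLie.c β hβ ∈ T := Submodule.subset_span (Or.inr rfl)
        -- If normal ordering reverses the product, undoing it costs a multiple of `c`; otherwise
        -- `a(m) b(n)` is exactly `2 L_{a,b}(m, n)`.
        by_cases hmn : n ≤ m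
        · convert add_mem (T.smul_mem 2 hL)
            (T.smul_mem (modeForm β (.single m a) (.single n b)) hc) using 1
          refine Subtype.ext ?_
          change mode β hβ a m * mode β hβ b n = (2 : ℂ) • ((1 / 2 : ℂ) •
            normalOrder β hβ a b m n) + modeForm β (.single m a) (.single n b) • central β hβ
          rw [normalOrder, if_pos hmn, smul_smul]
          norm_num
          exact loop_comm β hβ _ _
        · convert T.smul_mem 2 hL using 1
          refine Subtype.ext ?_
          change mode β hβ a m * mode β hβ b n = (2 : ℂ) • ((1 / 2 : ℂ) •
            normalOrder β hβ a b m n)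
          rw [normalOrder, if_neg hmn, smul_smul]
          norm_num
      · exact Submodule.subset_span (Or.inr rfl)
  exact key x.1 x.2

/-- The product of the operators `L_{a,b}(m, n)` over a list. -/
def opList (l : List (h × h × ℤ × ℤ)) : UQuad β hβ :=
  (l.map fun p => opL β hβ p.1 p.2.1 p.2.2.1 p.2.2.2).prod

theorem opList_cons (p : h × h × ℤ × ℤ) (l : List (h × h × ℤ × ℤ)) :
    opList β hβ (p :: l) = opL β hβ p.1 p.2.1 p.2.2.1 p.2.2.2 * opList β hβ l := by
  rw [opList, List.map_cons, List.prod_cons, opList]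

theorem opList_eq_ofFn (l : List (h × h × ℤ × ℤ)) :
    opList β hβ l = (List.ofFn fun i => opL β hβ (l.get i).1 (l.get i).2.1 (l.get i).2.2.1
      (l.get i).2.2.2).prod := by
  rw [opList]
  congr 1
  conv_lhs => rw [← List.ofFn_get l]
  rw [List.map_ofFn]
  rfl

theorem iota_c_commute (x : quadLie β hβ) :
    Commute (UniversalEnvelopingAlgebra.ι ℂ (quadLie.c β hβ) : UQuad β hβ)
      (UniversalEnvelopingAlgebra.ι ℂ x) := by
  have h0 : ⁅quadLie.c β hβ, x⁆ = 0 := by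
    refine quadLie.ext_polyHom ?_
    rw [quadLie.polyHom_lie, quadLie.c, quadLie.toU_mk, polyHom_central, one_mul, mul_one,
      sub_self, map_zero, map_zero]
  rw [Commute, SemiconjBy, ← sub_eq_zero, ← LieRing.of_associative_ring_bracket,
    ← LieHom.map_lie, h0, map_zero]

/-- Words in the generators span, and since `c` is central in `U(𝔏)` its occurrences can be
collected on the right. The operators `L_{a,b}(m, n)` are left in arbitrary order. -/
theorem span_opList_mul_pow :
    Submodule.span ℂ {u : UQuad β hβ | ∃ (l : List (h × h × ℤ × ℤ)) (j : ℕ),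
      u = opList β hβ l * UniversalEnvelopingAlgebra.ι ℂ (quadLie.c β hβ) ^ j} = ⊤ := by
  refine envelopingAlgebra_eq_top (Submodule.subset_span ⟨[], 0, by simp [opList]⟩)
    fun x u hu => ?_
  induction hu using Submodule.span_induction with
  | zero => simp
  | add u v _ _ hu hv => rw [mul_add]; exact add_mem hu hv
  | smul t u _ hu => rw [mul_smul_comm]; exact Submodule.smul_mem _ t hu
  | mem u hu =>
    obtain ⟨l, j, rfl⟩ := hu
    have hx := mem_span_quadL β hβ x
    induction hx using Submodule.span_induction with
    | zero => simp
    | add x y _ _ hx hy => rw [map_add, add_mul]; exact add_mem hx hy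
    | smul t x _ hx => rw [map_smul, smul_mul_assoc]; exact Submodule.smul_mem _ t hx
    | mem x hx =>
      refine Submodule.subset_span ?_
      rcases hx with ⟨a, b, m, n, rfl⟩ | rfl
      · refine ⟨(a, b, m, n) :: l, j, ?_⟩
        rw [opList_cons, mul_assoc]
        rfl
      · refine ⟨l, j + 1, ?_⟩
        have : Commute (UniversalEnvelopingAlgebra.ι ℂ (quadLie.c β hβ)) (opList β hβ l) := by
          refine Commute.list_prod_right _ _ fun u hu => ?_
          obtain ⟨p, -, rfl⟩ := List.mem_map.mp hu
          exact iota_c_commute β hβ _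
        rw [← mul_assoc, this.eq, mul_assoc, pow_succ']

/-! ### Interpolation in the number of colours -/

/-- The action of `U(𝔏)` on the Fock space with `N` colours. -/
def fockAction (N : ℕ) : UQuad β hβ →ₐ[ℂ] Module.End ℂ (FockRep h (Fin N)) :=
  UniversalEnvelopingAlgebra.lift ℂ (fockLie β hβ (Fin N))

theorem fockAction_iota (N : ℕ) (x : quadLie β hβ) :
    fockAction β hβ N (UniversalEnvelopingAlgebra.ι ℂ x) = fockLie β hβ (Fin N) x :=
  UniversalEnvelopingAlgebra.lift_ι_apply ℂ _ x

/-- The vacuum expectation value on the Fock space with `N` colours. -/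
def fockFunctional (N : ℕ) : UQuad β hβ →ₗ[ℂ] ℂ :=
  vacuumExpectation h (Fin N) ∘ₗ (fockAction β hβ N).toLinearMap

theorem fockFunctional_apply (N : ℕ) (u : UQuad β hβ) :
    fockFunctional β hβ N u = vacuumExpectation h (Fin N) (fockAction β hβ N u) := rfl

theorem fockFunctional_mul_c (N : ℕ) (u : UQuad β hβ) :
    fockFunctional β hβ N (u * UniversalEnvelopingAlgebra.ι ℂ (quadLie.c β hβ)) =
      N * fockFunctional β hβ N u := by
  rw [fockFunctional_apply, map_mul, fockAction_iota, fockLie_c, mul_smul_comm, mul_one, map_smul,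
    smul_eq_mul, Fintype.card_fin, fockFunctional_apply]

/-- The sum over all diagrams with `c` as the indeterminate. -/
def diagramPolynomial {n : ℕ} (a b : Fin n → h) (k : Vertex n → ℤ) : Polynomial ℂ :=
  ∑ D ∈ diagrams n,
    Polynomial.X ^ cycleCount D * Polynomial.C (∏ e ∈ D, edgeCoeff β hβ a b k e)

theorem eval_diagramPolynomial (r : ℂ) {n : ℕ} (a b : Fin n → h) (k : Vertex n → ℤ) :
    (diagramPolynomial β hβ a b k).eval r = ∑ D ∈ diagrams n, diagramCoeff β hβ r a b D k := by
  simp [diagramPolynomial, Polynomial.eval_finsetSum, Polynomial.eval_prod, diagramCoeff]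

theorem fockFunctional_prod (N : ℕ) {n : ℕ} (a b : Fin n → h) (k : Vertex n → ℤ) :
    fockFunctional β hβ N (List.ofFn fun i =>
      opL β hβ (a i) (b i) (-k (.inl i) - 1) (-k (.inr i) - 1)).prod =
      (diagramPolynomial β hβ a b k).eval (N : ℂ) := by
  rw [eval_diagramPolynomial, ← vacuumExpectation_prod_quadL, fockFunctional_apply, map_list_prod,
    List.map_ofFn]
  congr 3
  funext i
  exact fockAction_iota β hβ N _

/-- Evaluation of polynomials at the natural numbers. -/
def evalNat : Polynomial ℂ →ₗ[ℂ] ℕ → ℂ :=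
  LinearMap.pi fun N => Polynomial.leval (N : ℂ)

theorem evalNat_apply (p : Polynomial ℂ) (N : ℕ) : evalNat p N = p.eval (N : ℂ) := rfl

theorem evalNat_injective : Function.Injective evalNat := by
  intro p q hpq
  refine Polynomial.eq_of_infinite_eval_eq p q
    ((Set.infinite_range_of_injective (Nat.cast_injective (R := ℂ))).mono ?_)
  rintro _ ⟨N, rfl⟩
  exact congrFun hpq N

/-- Polynomial dependence on `N` is a linear condition on `u`, so the spanning words suffice. There
the value is the diagram polynomial at `N`, with one more factor `N` for each `c`. -/
theorem fockFunctional_mem_range (u : UQuad β hβ) :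
    LinearMap.pi (fun N => fockFunctional β hβ N) u ∈ LinearMap.range evalNat := by
  have hu : u ∈ (⊤ : Submodule ℂ (UQuad β hβ)) := Submodule.mem_top
  rw [← span_opList_mul_pow] at hu
  induction hu using Submodule.span_induction with
  | zero => simp
  | add u v _ _ hu hv => rw [map_add]; exact add_mem hu hv
  | smul t u _ hu => rw [map_smul]; exact Submodule.smul_mem _ t hu
  | mem u hu =>
    obtain ⟨l, j, rfl⟩ := hu
    -- The mode `m` occurs with the variable to the power `-m - 1`; this relation is its own
    -- inverse.
    let k : Vertex l.length → ℤ :=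
      Sum.elim (fun i => -(l.get i).2.2.1 - 1) (fun i => -(l.get i).2.2.2 - 1)
    refine ⟨diagramPolynomial β hβ (fun i => (l.get i).1) (fun i => (l.get i).2.1) k *
      Polynomial.X ^ j, funext fun N => ?_⟩
    rw [evalNat_apply, LinearMap.pi_apply]
    induction j with
    | zero =>
      rw [pow_zero, pow_zero, mul_one, mul_one, ← fockFunctional_prod, opList_eq_ofFn]
      simp [k]
    | succ j ih =>
      rw [pow_succ, pow_succ, ← mul_assoc, ← mul_assoc, fockFunctional_mul_c, ← ih,
        Polynomial.eval_mul, Polynomial.eval_X, mul_comm]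

/-- The functional with values in polynomials that interpolates the vacuum expectation values on
the Fock spaces with any number of colours. -/
def polynomialFunctional : UQuad β hβ →ₗ[ℂ] Polynomial ℂ :=
  (LinearEquiv.ofInjective evalNat evalNat_injective).symm.toLinearMap ∘ₗ
    (LinearMap.pi fun N => fockFunctional β hβ N).codRestrict (LinearMap.range evalNat)
      (fockFunctional_mem_range β hβ)

theorem eval_polynomialFunctional (u : UQuad β hβ) (N : ℕ) :
    (polynomialFunctional β hβ u).eval (N : ℂ) = fockFunctional β hβ N u := by
  have : evalNat (polynomialFunctional β hβ u) =
      LinearMap.pi (fun N => fockFunctional β hβ N) u := by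
    rw [← LinearEquiv.ofInjective_apply (h := evalNat_injective) evalNat]
    simp [polynomialFunctional]
  exact congrFun this N

/-- Agreement at every natural number forces equality of polynomials, so the properties of the
interpolated functional can be checked on the Fock spaces. -/
theorem polynomialFunctional_eq {u : UQuad β hβ} {p : Polynomial ℂ}
    (hp : ∀ N : ℕ, fockFunctional β hβ N u = p.eval (N : ℂ)) : polynomialFunctional β hβ u = p :=
  evalNat_injective (funext fun N => (eval_polynomialFunctional β hβ u N).trans (hp N))

theorem polynomialFunctional_prod {n : ℕ} (a b : Fin n → h) (k : Vertex n → ℤ) :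
    polynomialFunctional β hβ (List.ofFn fun i =>
      opL β hβ (a i) (b i) (-k (.inl i) - 1) (-k (.inr i) - 1)).prod =
      diagramPolynomial β hβ a b k :=
  polynomialFunctional_eq β hβ fun N => fockFunctional_prod β hβ N a b k

theorem polynomialFunctional_one : polynomialFunctional β hβ 1 = 1 :=
  polynomialFunctional_eq β hβ fun N => by
    rw [fockFunctional_apply, map_one, vacuumExpectation_one, Polynomial.eval_one]

theorem polynomialFunctional_mul_c (u : UQuad β hβ) :
    polynomialFunctional β hβ (u * UniversalEnvelopingAlgebra.ι ℂ (quadLie.c β hβ)) =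
      Polynomial.X * polynomialFunctional β hβ u :=
  polynomialFunctional_eq β hβ fun N => by
    rw [fockFunctional_mul_c, Polynomial.eval_mul, Polynomial.eval_X, eval_polynomialFunctional]

theorem polynomialFunctional_mul_of_mem (u : UQuad β hβ) {x : quadLie β hβ}
    (hx : x ∈ quadBPlus β hβ) :
    polynomialFunctional β hβ (u * UniversalEnvelopingAlgebra.ι ℂ x) = 0 := by
  induction hx using Submodule.span_induction with
  | zero => simp
  | add x y _ _ hx hy => rw [map_add, mul_add, map_add, hx, hy, add_zero]
  | smul t x _ hx => rw [map_smul, mul_smul_comm, map_smul, hx, smul_zero]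
  | mem x hx =>
    obtain ⟨a, b, m, n, hmn, rfl⟩ := hx
    refine polynomialFunctional_eq β hβ fun N => ?_
    rw [fockFunctional_apply, map_mul, fockAction_iota, vacuumExpectation_mul_fockLie β hβ hmn,
      Polynomial.eval_zero]

theorem polynomialFunctional_opL_mul {a b : h} {m n : ℤ} (hm : m < 0) (hn : n < 0)
    (u : UQuad β hβ) : polynomialFunctional β hβ (opL β hβ a b m n * u) = 0 := by
  refine polynomialFunctional_eq β hβ fun N => ?_
  rw [fockFunctional_apply, map_mul, opL, fockAction_iota,
    vacuumExpectation_fockLie_mul β hβ hm hn, Polynomial.eval_zero]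

/-! ### Descent to `M_r` and existence of `1'` -/

variable (r : ℂ)

/-- The generators of the ideal are killed as right factors: those from `𝔅₊` already in `ℂ[X]`, and
`c - r` because it becomes `X - r`. An arbitrary left factor `u` makes the statement stable under
left multiplication in the ideal. -/
theorem eval_polynomialFunctional_of_mem {x : UQuad β hβ} (hx : x ∈ vacuumIdeal β hβ r)
    (u : UQuad β hβ) : (polynomialFunctional β hβ (u * x)).eval r = 0 := by
  induction hx using Submodule.span_induction generalizing u with
  | zero => simp
  | add x y _ _ hx hy => rw [mul_add, map_add, Polynomial.eval_add, hx, hy, add_zero]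
  | smul w x _ hx => rw [smul_eq_mul, ← mul_assoc]; exact hx (u * w)
  | mem x hx =>
    rcases hx with ⟨x, hx, rfl⟩ | rfl
    · rw [polynomialFunctional_mul_of_mem β hβ u hx, Polynomial.eval_zero]
    · rw [mul_sub, map_sub, polynomialFunctional_mul_c, ← Algebra.commutes, ← Algebra.smul_def,
        map_smul]
      simp

/-- The functional `1'` on `M_r`. -/
def vacuumFunctional : Module.Dual ℂ (VacModule β hβ r) :=
  ((vacuumIdeal β hβ r).restrictScalars ℂ).liftQ
      (Polynomial.leval r ∘ₗ polynomialFunctional β hβ) (fun x hx => by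
        have := eval_polynomialFunctional_of_mem β hβ r hx 1
        rwa [one_mul] at this) ∘ₗ
    (Submodule.Quotient.restrictScalarsEquiv ℂ (vacuumIdeal β hβ r)).symm.toLinearMap

theorem smul_vacuum (u : UQuad β hβ) :
    u • vacuum β hβ r = (vacuumIdeal β hβ r).mkQ u := by
  rw [vacuum, ← map_smul, smul_eq_mul, mul_one]

theorem vacuumFunctional_smul_vacuum (u : UQuad β hβ) :
    vacuumFunctional β hβ r (u • vacuum β hβ r) = (polynomialFunctional β hβ u).eval r := by
  rw [smul_vacuum]
  rfl

/-- A spanning vector of positive degree comes from a nonempty word, whose leftmost operator has two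
negative modes and hence expectation zero at every level. -/
theorem isVacuumDual_vacuumFunctional : IsVacuumDual β hβ r (vacuumFunctional β hβ r) where
  map_vacuum := by
    rw [← one_smul (UQuad β hβ) (vacuum β hβ r), vacuumFunctional_smul_vacuum,
      polynomialFunctional_one, Polynomial.eval_one]
  map_positive k hk v hv := by
    induction hv using Submodule.span_induction with
    | zero => simp
    | add v w _ _ hv hw => rw [map_add, hv, hw, add_zero]
    | smul t v _ hv => rw [map_smul, hv, smul_zero]
    | mem v hv =>
      obtain ⟨s, a, b, m, n, hmn, hsum, rfl⟩ := hv
      cases s with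
      | zero =>
        rw [Finset.univ_eq_empty, Finset.sum_empty] at hsum
        lia
      | succ s =>
        have := hmn 0
        rw [vacuumFunctional_smul_vacuum, List.ofFn_succ, List.prod_cons,
          polynomialFunctional_opL_mul β hβ (by lia) (by lia), Polynomial.eval_zero]

theorem iota_c_smul_vacuum :
    (UniversalEnvelopingAlgebra.ι ℂ (quadLie.c β hβ) : UQuad β hβ) • vacuum β hβ r =
      r • vacuum β hβ r := by
  have hmem : UniversalEnvelopingAlgebra.ι ℂ (quadLie.c β hβ) - algebraMap ℂ (UQuad β hβ) r ∈
      vacuumIdeal β hβ r := Submodule.subset_span (Or.inr rfl)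
  have h0 : (UniversalEnvelopingAlgebra.ι ℂ (quadLie.c β hβ) - algebraMap ℂ (UQuad β hβ) r) •
      vacuum β hβ r = 0 := by
    rw [smul_vacuum]
    exact (Submodule.Quotient.mk_eq_zero _).mpr hmem
  rw [sub_smul, sub_eq_zero, algebraMap_smul] at h0
  exact h0

/-! ### Spanning of `M_r` by negative modes and uniqueness of `1'` -/

/-- The span of the vectors `L_{a₁,b₁}(-m₁,-n₁) ⋯ L_{aₛ,bₛ}(-mₛ,-nₛ) 1`. -/
def creationSpan : Submodule ℂ (VacModule β hβ r) :=
  Submodule.span ℂ {v | ∃ l : List (h × h × ℤ × ℤ), (∀ p ∈ l, p.2.2.1 < 0 ∧ p.2.2.2 < 0) ∧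
    v = opList β hβ l • vacuum β hβ r}

theorem opL_smul_mem_creationSpan (a b : h) {m n : ℤ} (hm : m < 0) (hn : n < 0)
    {v : VacModule β hβ r} (hv : v ∈ creationSpan β hβ r) :
    opL β hβ a b m n • v ∈ creationSpan β hβ r := by
  induction hv using Submodule.span_induction with
  | zero => simp
  | add v w _ _ hv hw => rw [smul_add]; exact add_mem hv hw
  | smul t v _ hv => rw [smul_comm]; exact Submodule.smul_mem _ t hv
  | mem v hv =>
    obtain ⟨l, hl, rfl⟩ := hv
    refine Submodule.subset_span ⟨(a, b, m, n) :: l, ?_, ?_⟩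
    · intro p hp
      rcases List.mem_cons.mp hp with rfl | hp
      · exact ⟨hm, hn⟩
      · exact hl p hp
    · rw [opList_cons, mul_smul]

theorem vacuum_mem_creationSpan : vacuum β hβ r ∈ creationSpan β hβ r :=
  Submodule.subset_span ⟨[], by simp, by simp [opList]⟩

/-- Moving `x` to the right past the first operator leaves a commutator that is again an element of
`𝔏` acting on a shorter word, so the induction must run over all `x`. At the vacuum, `𝔅₊` acts by
zero and `c` by `r`, leaving only negative modes. -/
theorem iota_smul_opList_mem (x : quadLie β hβ) {l : List (h × h × ℤ × ℤ)}
    (hl : ∀ p ∈ l, p.2.2.1 < 0 ∧ p.2.2.2 < 0) :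
    (UniversalEnvelopingAlgebra.ι ℂ x : UQuad β hβ) • opList β hβ l • vacuum β hβ r ∈
      creationSpan β hβ r := by
  induction l generalizing x with
  | nil =>
    rw [opList, List.map_nil, List.prod_nil, one_smul]
    have hx := mem_span_quadL β hβ x
    induction hx using Submodule.span_induction with
    | zero => simp
    | add x y _ _ hx hy => rw [map_add, add_smul]; exact add_mem hx hy
    | smul t x _ hx => rw [map_smul, smul_assoc]; exact Submodule.smul_mem _ t hx
    | mem x hx =>
      rcases hx with ⟨a, b, m, n, rfl⟩ | rfl
      · by_cases hmn : m < 0 ∧ n < 0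
        · exact opL_smul_mem_creationSpan β hβ r a b hmn.1 hmn.2
            (vacuum_mem_creationSpan β hβ r)
        · have hmem : (UniversalEnvelopingAlgebra.ι ℂ (quadL β hβ a b m n) : UQuad β hβ) ∈
              vacuumIdeal β hβ r :=
            Submodule.subset_span (Or.inl ⟨_, Submodule.subset_span
              ⟨a, b, m, n, by lia, rfl⟩, rfl⟩)
          rw [smul_vacuum, Submodule.mkQ_apply, (Submodule.Quotient.mk_eq_zero _).mpr hmem]
          exact zero_mem _
      · rw [iota_c_smul_vacuum]
        exact Submodule.smul_mem _ r (vacuum_mem_creationSpan β hβ r)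
  | cons p l ih =>
    have hl' : ∀ p ∈ l, p.2.2.1 < 0 ∧ p.2.2.2 < 0 := fun p hp => hl p (List.mem_cons_of_mem _ hp)
    obtain ⟨hm, hn⟩ := hl p List.mem_cons_self
    have hcomm : (UniversalEnvelopingAlgebra.ι ℂ x : UQuad β hβ) *
        opL β hβ p.1 p.2.1 p.2.2.1 p.2.2.2 =
        opL β hβ p.1 p.2.1 p.2.2.1 p.2.2.2 * UniversalEnvelopingAlgebra.ι ℂ x +
          UniversalEnvelopingAlgebra.ι ℂ ⁅x, quadL β hβ p.1 p.2.1 p.2.2.1 p.2.2.2⁆ := by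
      rw [LieHom.map_lie, LieRing.of_associative_ring_bracket, opL]
      abel
    rw [opList_cons, ← mul_smul, ← mul_assoc, hcomm, add_mul, add_smul, mul_assoc, mul_smul,
      mul_smul, mul_smul]
    exact add_mem (opL_smul_mem_creationSpan β hβ r _ _ hm hn (ih x hl')) (ih _ hl')

theorem creationSpan_eq_top : creationSpan β hβ r = ⊤ := by
  have hstable : ∀ x : quadLie β hβ, ∀ v ∈ creationSpan β hβ r,
      (UniversalEnvelopingAlgebra.ι ℂ x : UQuad β hβ) • v ∈ creationSpan β hβ r := by
    intro x v hv
    induction hv using Submodule.span_induction with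
    | zero => simp
    | add v w _ _ hv hw => rw [smul_add]; exact add_mem hv hw
    | smul t v _ hv => rw [smul_comm]; exact Submodule.smul_mem _ t hv
    | mem v hv =>
      obtain ⟨l, hl, rfl⟩ := hv
      exact iota_smul_opList_mem β hβ r x hl
  let f : UQuad β hβ →ₗ[ℂ] VacModule β hβ r := (vacuumIdeal β hβ r).mkQ.restrictScalars ℂ
  have hf : ∀ u, f u = u • vacuum β hβ r := fun u => (smul_vacuum β hβ r u).symm
  have htop : (creationSpan β hβ r).comap f = ⊤ := by
    refine envelopingAlgebra_eq_top ?_ fun x u hu => ?_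
    · rw [Submodule.mem_comap, hf, one_smul]
      exact vacuum_mem_creationSpan β hβ r
    · rw [Submodule.mem_comap, hf] at hu ⊢
      rw [mul_smul]
      exact hstable x _ hu
  refine Submodule.eq_top_iff'.mpr fun v => ?_
  obtain ⟨u, rfl⟩ := (vacuumIdeal β hβ r).mkQ_surjective v
  exact (htop ▸ Submodule.mem_top : u ∈ (creationSpan β hβ r).comap f)

variable {r}

theorem opList_smul_vacuum_mem_degreeSpace {l : List (h × h × ℤ × ℤ)}
    (hl : ∀ p ∈ l, p.2.2.1 < 0 ∧ p.2.2.2 < 0) (hne : l ≠ []) :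
    ∃ k, 1 ≤ k ∧ opList β hβ l • vacuum β hβ r ∈ degreeSpace β hβ r k := by
  have hneg : ∀ i, (l.get i).2.2.1 < 0 ∧ (l.get i).2.2.2 < 0 := fun i => hl _ (l.get_mem i)
  refine ⟨_, ?_, Submodule.subset_span ⟨l.length, fun i => (l.get i).1, fun i => (l.get i).2.1,
    fun i => (-(l.get i).2.2.1).toNat, fun i => (-(l.get i).2.2.2).toNat, ?_, rfl, ?_⟩⟩
  · have hpos : 0 < l.length := List.length_pos_iff.mpr hne
    have h0 := hneg ⟨0, hpos⟩
    refine le_trans ?_ (Finset.single_le_sum (fun _ _ => Nat.zero_le _)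
      (Finset.mem_univ (⟨0, hpos⟩ : Fin l.length)))
    lia
  · intro i
    have := hneg i
    lia
  · rw [opList_eq_ofFn]
    congr 4
    funext i
    have := hneg i
    congr 1 <;> lia

/-- The words with negative modes span `M_r`. The empty one is the vacuum, and the others have
positive degree, so the two conditions fix all values. -/
theorem IsVacuumDual.unique {φ ψ : Module.Dual ℂ (VacModule β hβ r)}
    (hφ : IsVacuumDual β hβ r φ) (hψ : IsVacuumDual β hβ r ψ) : φ = ψ := by
  refine LinearMap.ext_on (creationSpan_eq_top β hβ r) ?_
  rintro _ ⟨l, hl, rfl⟩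
  by_cases hne : l = []
  · rw [hne, opList, List.map_nil, List.prod_nil, one_smul, hφ.map_vacuum, hψ.map_vacuum]
  · obtain ⟨k, hk, hv⟩ := opList_smul_vacuum_mem_degreeSpace β hβ (r := r) hl hne
    rw [hφ.map_positive k hk _ hv, hψ.map_positive k hk _ hv]

theorem correlation_eq_sum_diagramCoeff {φ : Module.Dual ℂ (VacModule β hβ r)}
    (hφ : IsVacuumDual β hβ r φ) {n : ℕ} (a b : Fin n → h) (k : Vertex n → ℤ) :
    correlation β hβ φ a b k = ∑ D ∈ diagrams n, diagramCoeff β hβ r a b D k := by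
  rw [hφ.unique β hβ (isVacuumDual_vacuumFunctional β hβ r), correlation,
    vacuumFunctional_smul_vacuum, polynomialFunctional_prod, eval_diagramPolynomial]

end Functional

/-! ### Convergence -/

/-- Summability in `ℂ` is absolute, so a finite product of convergent series may be multiplied out
over all tuples of indices. -/
theorem hasSum_fin_pi_prod {n : ℕ} {f : Fin n → ℕ → ℂ} {s : Fin n → ℂ}
    (hf : ∀ i, HasSum (f i) (s i)) :
    HasSum (fun l : Fin n → ℕ => ∏ i, f i (l i)) (∏ i, s i) := by
  induction n with
  | zero => simp [hasSum_unique]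
  | succ n ih =>
    have htail := ih fun i => hf i.succ
    have h0 := hf 0
    rw [← (Fin.consEquiv fun _ => ℕ).hasSum_iff, Fin.prod_univ_succ]
    have hsum := summable_mul_of_summable_norm h0.summable.norm htail.summable.norm
    convert h0.mul htail hsum using 1
    · rfl
    funext x
    simp [Fin.consEquiv, Fin.prod_univ_succ]

theorem hasSum_pi_prod {ι : Type*} [Fintype ι] {f : ι → ℕ → ℂ} {s : ι → ℂ}
    (hf : ∀ i, HasSum (f i) (s i)) :
    HasSum (fun l : ι → ℕ => ∏ i, f i (l i)) (∏ i, s i) := by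
  let e := Fintype.equivFin ι
  have := hasSum_fin_pi_prod fun i => hf (e.symm i)
  rw [← (e.arrowCongr (Equiv.refl ℕ)).hasSum_iff, e.symm.prod_comp s] at this
  convert this using 1
  funext l
  simp only [Function.comp_apply, Equiv.arrowCongr_apply, Equiv.coe_refl, id]
  exact (e.symm.prod_comp fun i => f i (l i)).symm

/-- The expansion of `(x - y)⁻²` for `|y| < |x|`. -/
theorem hasSum_inv_sub_sq {x y : ℂ} (hxy : ‖y‖ < ‖x‖) (t : ℂ) :
    HasSum (fun l : ℕ => t * ((l : ℂ) + 1) * (x ^ (-2 - (l : ℤ)) * y ^ (l : ℤ)))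
      (t / (x - y) ^ 2) := by
  have hx : x ≠ 0 := by
    rintro rfl
    rw [norm_zero] at hxy
    exact (norm_nonneg y).not_gt hxy
  have hlt : ‖y / x‖ < 1 := by
    rw [norm_div]
    exact (div_lt_one (norm_pos_iff.mpr hx)).mpr hxy
  have hne : x - y ≠ 0 := by
    intro h0
    rw [sub_eq_zero.mp h0] at hxy
    exact lt_irrefl _ hxy
  -- This is `∑ (l + 1) q ^ l = (1 - q)⁻²` at `q = y / x`. The value `y = 0` is allowed, since only
  -- nonnegative powers of `y` occur.
  have := (hasSum_choose_mul_geometric_of_norm_lt_one 1 hlt).mul_left (t * x ^ (-2 : ℤ))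
  convert this using 1
  · rfl
  · funext l
    rw [zpow_sub₀ hx, zpow_natCast, zpow_natCast, div_pow, Nat.choose_one_right]
    push_cast
    ring
  · have h1 : (1 : ℂ) - y / x = (x - y) / x := by field_simp
    rw [h1, show (x : ℂ) ^ (-2 : ℤ) = (x ^ 2)⁻¹ by rw [zpow_neg]; rfl, div_pow]
    field_simp
    ring

section Convergence

variable {h : Type*} [AddCommGroup h] [Module ℂ h] (β : LinearMap.BilinForm ℂ h) (hβ : β.IsSymm)

theorem IsDiagram.exists_orientation {n : ℕ} {D : Finset (Sym2 (Vertex n))} (hD : IsDiagram D)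
    {e : Sym2 (Vertex n)} (he : e ∈ D) :
    ∃ p : Vertex n × Vertex n, e = s(p.1, p.2) ∧ pairIndex p.1 < pairIndex p.2 := by
  induction e with
  | h u v =>
    rcases lt_trichotomy (pairIndex u) (pairIndex v) with hlt | heq | hgt
    · exact ⟨(u, v), rfl, hlt⟩
    · exfalso
      have := hD.not_within_pair (pairIndex u)
      rcases u with i | i <;> rcases v with j | j <;> simp only [pairIndex, Sum.elim_inl,
        Sum.elim_inr, id] at heq this <;> subst heq
      · exact this.2.1 he
      · exact this.1 he
      · exact this.1 (Sym2.eq_swap ▸ he)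
      · exact this.2.2 he
    · exact ⟨(v, u), Sym2.eq_swap, hgt⟩

theorem edgeCoeff_mk_of_lt {n : ℕ} (a b : Fin n → h) (k : Vertex n → ℤ) {u v : Vertex n}
    (huv : pairIndex u < pairIndex v) : edgeCoeff β hβ a b k s(u, v) =
      1 / 2 * β (label a b u) (label a b v) * iotaCoeff (k u) (k v) := by
  rw [edgeCoeff, Sym2.lift_mk]
  simp only [if_pos huv]

/-- Every vertex lies on exactly one edge, so both the coefficient and the monomial factor over the
edges. An edge contributes only exponents `-2 - l` at its earlier end and `l ≥ 0` at its later end.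
The sum over integer exponents thus reduces to a sum over one natural number per edge, which is a
product of one-variable series. -/
theorem hasSum_prod_edgeCoeff {n : ℕ} (a b : Fin n → h) {D : Finset (Sym2 (Vertex n))}
    (hD : IsDiagram D) {x : Vertex n → ℂ}
    (hx : ∀ u v, pairIndex u < pairIndex v → ‖x v‖ < ‖x u‖) :
    HasSum (fun k : Vertex n → ℤ => (∏ e ∈ D, edgeCoeff β hβ a b k e) * ∏ v, x v ^ k v)
      (∏ e ∈ D, edgeWeight β hβ a b x e) := by
  classical
  have hM := hD.isPerfectMatching
  choose q hq hlt using fun e : D => hD.exists_orientation e.2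
  have hcover : ∀ v, ∃ e : D, v ∈ e.1 := fun v => by
    obtain ⟨e, he, hv⟩ := (hM.mem_iff v).mp (Finset.mem_univ v)
    exact ⟨⟨e, he⟩, hv⟩
  choose edge hmem using hcover
  have edge_eq : ∀ v, ∀ e : D, v ∈ e.1 → edge v = e := fun v e hv =>
    Subtype.ext (hM.eq_of_mem _ (edge v).2 e e.2 v (hmem v) hv)
  have edge_fst : ∀ e, edge (q e).1 = e := fun e =>
    edge_eq _ e (hq e ▸ Sym2.mem_mk_left _ _)
  have edge_snd : ∀ e, edge (q e).2 = e := fun e =>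
    edge_eq _ e (hq e ▸ Sym2.mem_mk_right _ _)
  have hne : ∀ e, (q e).1 ≠ (q e).2 := fun e h0 => (hlt e).ne (congrArg pairIndex h0)
  have hcases : ∀ v, v = (q (edge v)).1 ∨ v = (q (edge v)).2 := fun v => by
    have := hmem v
    rw [hq (edge v)] at this
    exact Sym2.mem_iff.mp this
  -- The exponents of the possibly nonzero terms, parametrized by the exponent at the later end `(q
  -- e).2` of each edge. The series is transported along this injection, and outside its range some
  -- edge coefficient vanishes.
  let g : (D → ℕ) → Vertex n → ℤ := fun l v =>
    if v = (q (edge v)).2 then (l (edge v) : ℤ) else -2 - l (edge v)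
  have hg2 : ∀ l (e : D), g l (q e).2 = l e := by
    intro l e
    simp only [g, edge_snd, if_true]
  have hg1 : ∀ l (e : D), g l (q e).1 = -2 - l e := by
    intro l e
    simp only [g, edge_fst, if_neg (hne e)]
  have hginj : Function.Injective g := by
    intro l l' hl
    funext e
    have := congrFun hl (q e).2
    rw [hg2, hg2] at this
    exact_mod_cast this
  have hcoeff : ∀ k, ∏ e ∈ D, edgeCoeff β hβ a b k e = ∏ e : D,
      (1 / 2 * β (label a b (q e).1) (label a b (q e).2) * iotaCoeff (k (q e).1) (k (q e).2)) := by
    intro k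
    rw [← Finset.prod_coe_sort]
    refine Finset.prod_congr rfl fun e _ => ?_
    conv_lhs => rw [hq e]
    exact edgeCoeff_mk_of_lt β hβ a b k (hlt e)
  have hvars : ∀ k : Vertex n → ℤ, ∏ v, x v ^ k v =
      ∏ e : D, (x (q e).1 ^ k (q e).1 * x (q e).2 ^ k (q e).2) := by
    intro k
    rw [← Finset.prod_fiberwise Finset.univ edge]
    refine Finset.prod_congr rfl fun e _ => ?_
    have : (Finset.univ.filter fun v => edge v = e) = {(q e).1, (q e).2} := by
      ext v
      simp only [Finset.mem_filter, Finset.mem_univ, true_and, Finset.mem_insert,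
        Finset.mem_singleton]
      constructor
      · rintro rfl
        exact hcases v
      · rintro (rfl | rfl)
        · exact edge_fst e
        · exact edge_snd e
    rw [this, Finset.prod_pair (hne e)]
  have hweight : ∏ e ∈ D, edgeWeight β hβ a b x e = ∏ e : D,
      (1 / 2 * β (label a b (q e).1) (label a b (q e).2) / (x (q e).1 - x (q e).2) ^ 2) := by
    rw [← Finset.prod_coe_sort]
    refine Finset.prod_congr rfl fun e _ => ?_
    conv_lhs => rw [hq e]
    rfl
  rw [hweight, ← hginj.hasSum_iff]
  · convert hasSum_pi_prod fun e : D => hasSum_inv_sub_sq (hx _ _ (hlt e))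
      (1 / 2 * β (label a b (q e).1) (label a b (q e).2)) using 1
    funext l
    rw [Function.comp_apply, hcoeff, hvars, ← Finset.prod_mul_distrib]
    refine Finset.prod_congr rfl fun e _ => ?_
    rw [hg1, hg2, iotaCoeff, if_pos (by lia), Int.cast_natCast]
  · intro k hk
    by_contra hne0
    refine hk ⟨fun e => (k (q e).2).toNat, ?_⟩
    have hiota : ∀ e : D, 0 ≤ k (q e).2 ∧ k (q e).1 + k (q e).2 = -2 := by
      intro e
      by_contra hcon
      refine hne0 ?_
      rw [hcoeff, Finset.prod_eq_zero (Finset.mem_univ e), zero_mul]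
      rw [iotaCoeff, if_neg hcon, mul_zero]
    funext v
    have := hiota (edge v)
    simp only [g]
    rcases hcases v with hv | hv
    · rw [if_neg (fun h' => hne _ (hv.symm.trans h'))]
      rw [← hv] at this
      lia
    · rw [if_pos hv]
      rw [← hv] at this ⊢
      lia

theorem hasSum_diagramCoeff (r : ℂ) {n : ℕ} (a b : Fin n → h) {x : Vertex n → ℂ}
    (hx : ∀ u v, pairIndex u < pairIndex v → ‖x v‖ < ‖x u‖) :
    HasSum (fun k : Vertex n → ℤ =>
        (∑ D ∈ diagrams n, diagramCoeff β hβ r a b D k) * ∏ v, x v ^ k v)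
      (∑ D ∈ diagrams n, diagramWeight β hβ r a b x D) := by
  simp only [Finset.sum_mul]
  refine hasSum_sum fun D hD => ?_
  have hD : IsDiagram D := by simpa [diagrams] using hD
  simpa only [diagramCoeff, diagramWeight, mul_assoc] using
    (hasSum_prod_edgeCoeff β hβ a b hD hx).mul_left (r ^ cycleCount D)

end Convergence

end
end JordanVOA

/-! ### The proposition -/

theorem proposition2 {h : Type*} [AddCommGroup h] [Module ℂ h] [FiniteDimensional ℂ h]
    (β : LinearMap.BilinForm ℂ h) (hβ : β.IsSymm) (_hnd : β.Nondegenerate) (r : ℂ) :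
    (∃! φ : Module.Dual ℂ (JordanVOA.VacModule β hβ r), JordanVOA.IsVacuumDual β hβ r φ) ∧
    ∀ φ : Module.Dual ℂ (JordanVOA.VacModule β hβ r), JordanVOA.IsVacuumDual β hβ r φ →
      ∀ (n : ℕ) (a b : Fin n → h),
        (∀ k : JordanVOA.Vertex n → ℤ,
          JordanVOA.correlation β hβ φ a b k =
            ∑ D ∈ JordanVOA.diagrams n, JordanVOA.diagramCoeff β hβ r a b D k) ∧
        (∀ x : JordanVOA.Vertex n → ℂ,
          (∀ u v, JordanVOA.pairIndex u < JordanVOA.pairIndex v → ‖x v‖ < ‖x u‖) →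
          HasSum (fun k : JordanVOA.Vertex n → ℤ =>
              JordanVOA.correlation β hβ φ a b k * ∏ v, x v ^ k v)
            (∑ D ∈ JordanVOA.diagrams n, JordanVOA.diagramWeight β hβ r a b x D)) := by
  refine ⟨⟨_, JordanVOA.isVacuumDual_vacuumFunctional β hβ r, fun φ hφ =>
    hφ.unique β hβ (JordanVOA.isVacuumDual_vacuumFunctional β hβ r)⟩,
    fun φ hφ n a b => ⟨JordanVOA.correlation_eq_sum_diagramCoeff β hβ hφ a b, fun x hx => ?_⟩⟩
  simp only [JordanVOA.correlation_eq_sum_diagramCoeff β hβ hφ a b]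
  exact JordanVOA.hasSum_diagramCoeff β hβ r a b hx
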